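/- **Setting.** Let $\mathcal X,\mathcal W$ be measurable spaces and $\nu$ a reference measure on $\mathcal X$ (for example Lebesgue measure on a subset of $\mathbb R^d$). The following are known and fixed: a population density $q$ and a sampling density $p$ on $\mathcal X$ with respect to $\nu$, an experimentation probability $\pi:\mathcal X\to[0,1]$, and a predictor $f:\mathcal X\times\mathcal W\to\mathbb R$ (all measurable). The unknown parameter is a Markov kernel $\kappa$, the conditional law of $(W,Y)\in\mathcal W\times\mathbb R$ given $X$; the model consists of all $\kappa$ for which $Y$ is integrable when $X\sim q$. The estimand is the population mean $\theta(\kappa)=\mathbb E[Y]$ for $X\sim q$, $(W,Y)\mid X\sim\kappa$. One observation is $Z=(X,F,\Delta,\Delta Y)$, where $X\sim p$, $(W,Y)\mid X\sim\kappa$, $F=f(X,W)$, and $\Delta\in\{0,1\}$ with $\mathbb P(\Delta=1\mid X,W,Y)=\pi(X)$. Let $P_\kappa$ be the law of $Z$. Write $\mathbb E[Y\mid X]$ and $\mathbb E[Y\mid X,F]$ for versions, as measurable functions of $X$ and of $(X,F)$, of the conditional expectations in the population ($X\sim q$, $(W,Y)\mid X\sim\kappa$). **Efficient influence function.** A regular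 submodel through $\kappa$ with score $g\in L^2(P_\kappa)$ is a path $t\mapsto\kappa_t$ in the model with $\kappa_0=\kappa$ such that $$\int\Big(\frac{\sqrt{dP_{\kappa_t}}-\sqrt{dP_\kappa}}{t}-\tfrac12\,g\sqrt{dP_\kappa}\Big)^2\to0\qquad(t\downarrow0)$$ and such that $\mathbb E_{X\sim p,\,(W,Y)\mid X\sim\kappa_t}\big[\frac{q(X)^2}{p(X)^2\pi(X)}(Y-\mathbb E_\kappa[Y\mid X])^2\big]$ is bounded for all small $t>0$. The tangent set at $\kappa$ is the set of scores of all regular submodels through $\kappa$. An efficient influence function of $\theta$ at $\kappa$ is a function $\psi\in L^2(P_\kappa)$ in the closed linear span of the tangent set such that, for every regular submodel with score $g$, $$\lim_{t\downarrow0}\frac{\theta(\kappa_t)-\theta(\kappa)}{t}=\int\psi\,g\,dP_\kappa .$$ **Lemma.** Suppose that $p>0$ and $\pi>0$ at $\nu$-almost every point where $q>0$. Let $\kappa$ be in the model with $$\mathbb E_{X\sim p,\,(W,Y)\mid X\sim\kappa}\Big[\frac{q(X)^2}{p(X)^2\pi(X)}\big(Y-\mathbb E[Y\mid X]\big)^2\Big]<\infty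 .$$ (Quotients are read as $0$ where the denominator vanishes, which up to null sets of $X\sim p$ happens only where $q=0$.) Then $$\dot\Psi(Z)=\frac{\Delta\,q(X)}{\pi(X)p(X)}\big(Y-\mathbb E[Y\mid X]\big)+\frac{(\Delta-\pi(X))\,q(X)}{\pi(X)p(X)}\big(\mathbb E[Y\mid X]-\mathbb E[Y\mid X,F]\big)$$ is an efficient influence function of $\theta$ at $\kappa$ from the observation $Z=(X,F,\Delta,\Delta Y)$, and every efficient influence function of $\theta$ at $\kappa$ equals $\dot\Psi$ $P_\kappa$-almost everywhere. -/

import Mathlib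

open MeasureTheory ProbabilityTheory Filter Topology
open scoped ENNReal NNReal

/-- The known ingredients of a prediction-guided experiment: the population density `q` and the
sampling density `p` of the covariate (with respect to a reference measure `ν`), the
experimentation probability `π`, and the predictor `f`, which turns the covariate and some side
information into a prediction. -/
structure Experiment (𝒳 𝒲 : Type*) [MeasurableSpace 𝒳] [MeasurableSpace 𝒲] where
  ν : Measure 𝒳
  q : 𝒳 → ℝ
  p : 𝒳 → ℝ
  π : 𝒳 → ℝ
  f : 𝒳 → 𝒲 → ℝ
  measurable_q : Measurable q
  measurable_p : Measurable p
  measurable_π : Measurable π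
  measurable_f : Measurable (Function.uncurry f)
  q_nonneg : ∀ x, 0 ≤ q x
  p_nonneg : ∀ x, 0 ≤ p x
  lintegral_q : ∫⁻ x, ENNReal.ofReal (q x) ∂ν = 1
  lintegral_p : ∫⁻ x, ENNReal.ofReal (p x) ∂ν = 1
  π_nonneg : ∀ x, 0 ≤ π x
  π_le_one : ∀ x, π x ≤ 1

/-- A path `t ↦ P t` of measures, starting at `P₀` for `t = 0`, is differentiable in quadratic mean
as `t ↓ 0` with score `g`:
`∫ ((√dP_t - √dP₀) / t - (1/2) g √dP₀)² → 0`.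
The densities are taken with respect to the dominating measure `P₀ + P t`; the integral does not
depend on the choice of the dominating measure. -/
def DifferentiableInQuadraticMean {Z : Type*} [MeasurableSpace Z]
    (P₀ : Measure Z) (P : ℝ → Measure Z) (g : Z → ℝ) : Prop :=
  Tendsto
    (fun t : ℝ => ∫⁻ z, ENNReal.ofReal
      (((√((P t).rnDeriv (P₀ + P t) z).toReal - √(P₀.rnDeriv (P₀ + P t) z).toReal) / t
        - 1 / 2 * g z * √(P₀.rnDeriv (P₀ + P t) z).toReal) ^ 2) ∂(P₀ + P t))
    (𝓝[>] 0) (𝓝 0)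

namespace Experiment

variable {𝒳 𝒲 : Type*} [MeasurableSpace 𝒳] [MeasurableSpace 𝒲]

/-- The joint law of `(X, W, Y)` in the population: `X` has density `q` and `(W, Y)` has conditional
law `κ` given `X`. The kernel `κ` is the unknown parameter of the model. -/
noncomputable def populationLaw (E : Experiment 𝒳 𝒲) (κ : Kernel 𝒳 (𝒲 × ℝ)) :
    Measure (𝒳 × 𝒲 × ℝ) :=
  (E.ν.withDensity fun x => ENNReal.ofReal (E.q x)) ⊗ₘ κ

/-- The joint law of `(X, W, Y)` for a sampled individual: `X` has density `p` and `(W, Y)` has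
conditional law `κ` given `X`. -/
noncomputable def samplingLaw (E : Experiment 𝒳 𝒲) (κ : Kernel 𝒳 (𝒲 × ℝ)) :
    Measure (𝒳 × 𝒲 × ℝ) :=
  (E.ν.withDensity fun x => ENNReal.ofReal (E.p x)) ⊗ₘ κ

/-- The joint law of `((X, W, Y), Δ)`: given `(X, W, Y)`, the indicator `Δ` is `1` with probability
`π X` and `0` with probability `1 - π X`. -/
noncomputable def fullDataLaw (E : Experiment 𝒳 𝒲) (κ : Kernel 𝒳 (𝒲 × ℝ)) :
    Measure ((𝒳 × 𝒲 × ℝ) × ℝ) :=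
  ((E.samplingLaw κ).withDensity fun u => ENNReal.ofReal (E.π u.1)).map (fun u => (u, 1))
    + ((E.samplingLaw κ).withDensity fun u => ENNReal.ofReal (1 - E.π u.1)).map (fun u => (u, 0))

/-- The observation `Z = (X, F, Δ, ΔY)` with `F = f(X, W)`. -/
def observe (E : Experiment 𝒳 𝒲) (u : (𝒳 × 𝒲 × ℝ) × ℝ) : 𝒳 × ℝ × ℝ × ℝ :=
  (u.1.1, E.f u.1.1 u.1.2.1, u.2, u.2 * u.1.2.2)

/-- The law of one observation `Z = (X, F, Δ, ΔY)`. -/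
noncomputable def observedLaw (E : Experiment 𝒳 𝒲) (κ : Kernel 𝒳 (𝒲 × ℝ)) :
    Measure (𝒳 × ℝ × ℝ × ℝ) :=
  (E.fullDataLaw κ).map E.observe

/-- The parameter space: all conditional laws of `(W, Y)` given `X` for which the population mean of
`Y` exists. -/
structure InModel (E : Experiment 𝒳 𝒲) (κ : Kernel 𝒳 (𝒲 × ℝ)) : Prop where
  isMarkovKernel : IsMarkovKernel κ
  integrable : Integrable (fun u => u.2.2) (E.populationLaw κ)

/-- The estimand `θ = E[Y]`, the mean outcome in the population. -/
noncomputable def theta (E : Experiment 𝒳 𝒲) (κ : Kernel 𝒳 (𝒲 × ℝ)) : ℝ :=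
  ∫ u, u.2.2 ∂(E.populationLaw κ)

/-- `μ` is a version of `x ↦ E[Y | X = x]`. -/
def IsOutcomeRegression (E : Experiment 𝒳 𝒲) (κ : Kernel 𝒳 (𝒲 × ℝ)) (μ : 𝒳 → ℝ) : Prop :=
  Measurable μ ∧
    (fun u : 𝒳 × 𝒲 × ℝ => μ u.1) =ᵐ[E.populationLaw κ]
      (E.populationLaw κ)[fun u => u.2.2 |
        MeasurableSpace.comap (fun u : 𝒳 × 𝒲 × ℝ => u.1) inferInstance]

/-- `τ` is a version of `(x, φ) ↦ E[Y | X = x, F = φ]`. -/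
def IsPredictionRegression (E : Experiment 𝒳 𝒲) (κ : Kernel 𝒳 (𝒲 × ℝ)) (τ : 𝒳 → ℝ → ℝ) : Prop :=
  Measurable (Function.uncurry τ) ∧
    (fun u : 𝒳 × 𝒲 × ℝ => τ u.1 (E.f u.1 u.2.1)) =ᵐ[E.populationLaw κ]
      (E.populationLaw κ)[fun u => u.2.2 |
        MeasurableSpace.comap (fun u : 𝒳 × 𝒲 × ℝ => (u.1, E.f u.1 u.2.1)) inferInstance]

/-- The weighted second moment `E[q(X)² / (p(X)² π(X)) (Y - m(X))²]`, where `(X, W, Y)` is sampled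
with `X ∼ p` and `(W, Y) | X ∼ κ'`, and `m(x) = ∫ y dκ(x)` is the regression of `Y` on `X`
under `κ`. For `κ' = κ` it equals `E[q(X)² / (p(X)² π(X)) Var(Y | X)]`. -/
noncomputable def residualMoment (E : Experiment 𝒳 𝒲) (κ κ' : Kernel 𝒳 (𝒲 × ℝ)) : ℝ≥0∞ :=
  ∫⁻ u, ENNReal.ofReal
    ((E.q u.1 / E.p u.1) ^ 2 / E.π u.1 * (u.2.2 - ∫ v, v.2 ∂(κ u.1)) ^ 2) ∂(E.samplingLaw κ')

/-- `path` is a regular submodel through `κ` with score `g`: it stays in the model, the laws of the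
observation are differentiable in quadratic mean with score `g`, and the weighted second moment of
the residual of the outcome stays bounded near `t = 0`. -/
structure IsRegularSubmodel (E : Experiment 𝒳 𝒲) (κ : Kernel 𝒳 (𝒲 × ℝ))
    (path : ℝ → Kernel 𝒳 (𝒲 × ℝ)) (g : 𝒳 × ℝ × ℝ × ℝ → ℝ) : Prop where
  start : path 0 = κ
  inModel : ∀ t, E.InModel (path t)
  score_memLp : MemLp g 2 (E.observedLaw κ)
  differentiable :
    DifferentiableInQuadraticMean (E.observedLaw κ) (fun t => E.observedLaw (path t)) g
  bounded : ∃ C : ℝ≥0, ∀ᶠ t in 𝓝[>] (0 : ℝ), E.residualMoment κ (path t) ≤ C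

/-- The tangent set at `κ`: the scores, in `L²` of the law of the observation, of all regular
submodels through `κ`. -/
def tangentSet (E : Experiment 𝒳 𝒲) (κ : Kernel 𝒳 (𝒲 × ℝ)) : Set (Lp ℝ 2 (E.observedLaw κ)) :=
  {g | ∃ path, E.IsRegularSubmodel κ path g}

/-- `ψ` is the efficient influence function of `θ` at `κ`: it is square integrable, the derivative
of `θ` along every regular submodel is the `L²` inner product of `ψ` with the score, and `ψ` belongs
to the closed linear span of the tangent set. -/
def IsEfficientInfluenceFunction (E : Experiment 𝒳 𝒲) (κ : Kernel 𝒳 (𝒲 × ℝ))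
    (ψ : 𝒳 × ℝ × ℝ × ℝ → ℝ) : Prop :=
  (∀ path g, E.IsRegularSubmodel κ path g →
    Tendsto (fun t : ℝ => (E.theta (path t) - E.theta κ) / t) (𝓝[>] 0)
      (𝓝 (∫ z, ψ z * g z ∂(E.observedLaw κ)))) ∧
  ∃ hψ : MemLp ψ 2 (E.observedLaw κ),
    hψ.toLp ψ ∈ (Submodule.span ℝ (E.tangentSet κ)).topologicalClosure

/-- The function
`Δ q(X) / (π(X) p(X)) (Y - μ(X)) + (Δ - π(X)) q(X) / (π(X) p(X)) (μ(X) - τ(X, F))`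
of the observation `z = (X, F, Δ, ΔY)`. The outcome enters it only through `Δ Y`, so `Y` is read off
from the last coordinate of `z`. -/
noncomputable def influence (E : Experiment 𝒳 𝒲) (μ : 𝒳 → ℝ) (τ : 𝒳 → ℝ → ℝ) :
    𝒳 × ℝ × ℝ × ℝ → ℝ :=
  fun ⟨x, φ, δ, v⟩ =>
    δ * E.q x / (E.π x * E.p x) * (v - μ x)
      + (δ - E.π x) * E.q x / (E.π x * E.p x) * (μ x - τ x φ)

end Experiment

/-! Write μ = E[Y | X], τ = E[Y | X, F]. The influence function is the sum of φ = Δ q / (π p) (Y -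
μ) and a multiple of Δ - π(X) by a function of (X, F).

Derivative of θ. By inverse probability weighting, the mean of φ under any κ' in the model is θ(κ')
minus ∫ μ q dν, with μ kept at its value for κ (`integral_weightedResidual`). Hence θ moves along a
path exactly as the mean of one fixed function does. The moment bound in a regular submodel is a
uniform bound on the second moment of φ (`lintegral_sq_weightedResidual`), which is what allows this
mean to be differentiated under differentiability in quadratic mean
(`DifferentiableInQuadraticMean.tendsto_integral`); the derivative is ∫ φ g. A function (Δ - π(X))
b(X, F) has mean zero under every κ' because π is known, so it is orthogonal to all scores
(`IsRegularSubmodel.integral_centeredIndicatorMul_mul`), and adding it to φ does not change the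
derivative.

Membership in the closed span. It suffices that every h orthogonal to the scores is orthogonal to
the influence function. Test h on the paths with density 1 + t s(X, F, Y) relative to κ, with s
bounded and E[s | X] = 0; their observed score is E[s | Z] (`observedLaw_perturb`). Passing to the
adjoint, E[h | X, F, Y] is orthogonal to all such s and is therefore a function c(X). On Δ = 0 the
observation reveals only (X, F), so where π > 0 the value of h on Δ = 1 is also a function w(X, F).
The inner product of h with the influence function then becomes the population mean of w(X, F)(Y -
τ) + c(X)(τ - μ), and both terms vanish by the defining property of conditional expectation
(`integral_mul_influence_eq_zero`).

Uniqueness. Two efficient influence functions have the same inner product with every score, and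
their difference lies in the closed span of the scores, so it is orthogonal to itself. -/

/-! ### Square integrability and the expansion of ∫ h α² -/

/-- Cauchy–Schwarz inequality for real square integrable functions. -/
theorem abs_integral_mul_le_sqrt_mul_sqrt {Z : Type*} [MeasurableSpace Z] {P : Measure Z}
    {u v : Z → ℝ} (hu : MemLp u 2 P) (hv : MemLp v 2 P) :
    |∫ z, u z * v z ∂P| ≤ √(∫ z, u z ^ 2 ∂P) * √(∫ z, v z ^ 2 ∂P) := by
  have h := integral_mul_norm_le_Lp_mul_Lq (μ := P) (f := u) (g := v) Real.HolderConjugate.two_two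
    (by simpa using hu) (by simpa using hv)
  refine (abs_integral_le_integral_abs).trans ?_
  simp only [Real.norm_eq_abs, Real.rpow_two, sq_abs, ← Real.sqrt_eq_rpow] at h
  simpa only [abs_mul] using h

theorem memLp_two_of_lintegral_sq_lt_top {Z : Type*} [MeasurableSpace Z] {P : Measure Z}
    {u : Z → ℝ} (hu : AEStronglyMeasurable u P)
    (h : ∫⁻ z, ENNReal.ofReal (u z ^ 2) ∂P < ∞) : MemLp u 2 P := by
  rw [memLp_two_iff_integrable_sq hu]
  exact (lintegral_ofReal_ne_top_iff_integrable (hu.pow 2)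
    (ae_of_all _ fun _ => sq_nonneg _)).1 h.ne

theorem integral_sq_eq_toReal_lintegral {Z : Type*} [MeasurableSpace Z] {P : Measure Z}
    {u : Z → ℝ} (hu : AEStronglyMeasurable u P) :
    ∫ z, u z ^ 2 ∂P = (∫⁻ z, ENNReal.ofReal (u z ^ 2) ∂P).toReal :=
  integral_eq_lintegral_of_nonneg_ae (ae_of_all _ fun _ => sq_nonneg _) (hu.pow 2)

theorem lintegral_sq_lt_top_of_memLp_two {Z : Type*} [MeasurableSpace Z] {P : Measure Z}
    {u : Z → ℝ} (hu : MemLp u 2 P) : ∫⁻ z, ENNReal.ofReal (u z ^ 2) ∂P < ∞ :=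
  hu.integrable_sq.lintegral_lt_top

/-- The error in the first-order expansion of `∫ h α²`, where `α` is close to
`β + t / 2 * (g * β)`. -/
theorem abs_integral_mul_sq_sub_sq_le {Z : Type*} [MeasurableSpace Z] {L : Measure Z}
    {h g α β : Z → ℝ} (hh : Measurable h) (hhα : MemLp (fun z => h z * α z) 2 L)
    (hhβ : MemLp (fun z => h z * β z) 2 L) (hgβ : MemLp (fun z => g z * β z) 2 L) {t : ℝ}
    (ht : 0 < t)
    (hD : MemLp (fun z => (α z - β z) / t - 1 / 2 * g z * β z) 2 L) {M : ℝ} (hM : 0 ≤ M) :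
    |∫ z, ((h z * α z ^ 2 - h z * β z ^ 2) / t - h z * g z * β z ^ 2) ∂L|
      ≤ (√(∫ z, (h z * α z) ^ 2 ∂L) + √(∫ z, (h z * β z) ^ 2 ∂L))
          * √(∫ z, ((α z - β z) / t - 1 / 2 * g z * β z) ^ 2 ∂L)
        + t * M * √(∫ z, (g z * β z) ^ 2 ∂L)
          * (√(∫ z, ((α z - β z) / t - 1 / 2 * g z * β z) ^ 2 ∂L) + √(∫ z, (g z * β z) ^ 2 ∂L))
        + √(∫ z, ({z | M < |h z|}.indicator (fun _ => 1) z * (g z * β z)) ^ 2 ∂L)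
          * (√(∫ z, (h z * α z) ^ 2 ∂L) + √(∫ z, (h z * β z) ^ 2 ∂L)) := by
  have hA : MeasurableSet {z | M < |h z|} := measurableSet_lt measurable_const hh.abs
  set D : Z → ℝ := fun z => (α z - β z) / t - 1 / 2 * g z * β z with hDdef
  set w : Z → ℝ := {z | M < |h z|}ᶜ.indicator h with hw
  set e : Z → ℝ := {z | M < |h z|}.indicator (fun _ => 1) with he
  have hwM : ∀ z, |w z| ≤ M := by
    intro z
    by_cases hz : M < |h z|
    · simp [hw, hz, hM]
    · simpa [hw, hz] using not_lt.1 hz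
  have he1 : ∀ z, |e z| ≤ 1 := by
    intro z
    by_cases hz : M < |h z| <;> simp [he, hz]
  have hwm : Measurable w := hh.indicator hA.compl
  have hem : Measurable e := measurable_const.indicator hA
  have hwg : MemLp (fun z => w z * (g z * β z)) 2 L :=
    hgβ.of_le_mul (c := M) (hwm.aestronglyMeasurable.mul hgβ.1) (ae_of_all _ fun z => by
      rw [norm_mul]; exact mul_le_mul_of_nonneg_right (hwM z) (norm_nonneg _))
  have heg : MemLp (fun z => e z * (g z * β z)) 2 L :=
    hgβ.of_le_mul (c := 1) (hem.aestronglyMeasurable.mul hgβ.1) (ae_of_all _ fun z => by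
      rw [norm_mul]; exact mul_le_mul_of_nonneg_right (he1 z) (norm_nonneg _))
  -- Factor α² - β² = (α - β)(α + β) and insert (α - β) / t = D + gβ / 2. What remains besides h (α
  -- + β) D is h gβ (α - β) / 2. Where |h| ≤ M, replace α - β by t (D + gβ / 2), which gains a
  -- factor t; where |h| > M, keep hα - hβ, whose L² norm is under control although h is unbounded.
  have key : ∀ z, (h z * α z ^ 2 - h z * β z ^ 2) / t - h z * g z * β z ^ 2
      = (h z * α z * D z + h z * β z * D z)
        + t * (1 / 2 * (w z * (g z * β z) * D z) + 1 / 4 * (w z * (g z * β z) * (g z * β z)))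
        + 1 / 2 * (e z * (g z * β z) * (h z * α z) - e z * (g z * β z) * (h z * β z)) := by
    intro z
    by_cases hz : M < |h z|
    · simp only [hw, he, hDdef, Set.indicator, Set.mem_compl_iff, Set.mem_ofPred_eq, hz,
        not_true_eq_false, if_true, if_false]
      field_simp
      ring
    · simp only [hw, he, hDdef, Set.indicator, Set.mem_compl_iff, Set.mem_ofPred_eq, hz,
        not_false_eq_true, if_true, if_false]
      field_simp
      ring
  have i1 : Integrable (fun z => h z * α z * D z) L := hhα.integrable_mul hD
  have i2 : Integrable (fun z => h z * β z * D z) L := hhβ.integrable_mul hD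
  have i3 : Integrable (fun z => w z * (g z * β z) * D z) L := hwg.integrable_mul hD
  have i4 : Integrable (fun z => w z * (g z * β z) * (g z * β z)) L := hwg.integrable_mul hgβ
  have i5 : Integrable (fun z => e z * (g z * β z) * (h z * α z)) L := heg.integrable_mul hhα
  have i6 : Integrable (fun z => e z * (g z * β z) * (h z * β z)) L := heg.integrable_mul hhβ
  have hwn : √(∫ z, (w z * (g z * β z)) ^ 2 ∂L) ≤ M * √(∫ z, (g z * β z) ^ 2 ∂L) := by
    rw [← Real.sqrt_sq hM, ← Real.sqrt_mul (sq_nonneg M), ← integral_const_mul]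
    refine Real.sqrt_le_sqrt (integral_mono hwg.integrable_sq (hgβ.integrable_sq.const_mul _)
      fun z => ?_)
    simp only [mul_pow (w z)]
    exact mul_le_mul_of_nonneg_right (sq_le_sq' (neg_le_of_abs_le (hwM z)) (le_of_abs_le (hwM z)))
      (sq_nonneg _)
  have b1 := abs_integral_mul_le_sqrt_mul_sqrt hhα hD
  have b2 := abs_integral_mul_le_sqrt_mul_sqrt hhβ hD
  have b3 := abs_integral_mul_le_sqrt_mul_sqrt hwg hD
  have b4 := abs_integral_mul_le_sqrt_mul_sqrt hwg hgβ
  have b5 := abs_integral_mul_le_sqrt_mul_sqrt heg hhα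
  have b6 := abs_integral_mul_le_sqrt_mul_sqrt heg hhβ
  simp_rw [key]
  rw [integral_add, integral_add, integral_add i1 i2, integral_const_mul, integral_add,
    integral_const_mul, integral_const_mul, integral_const_mul, integral_sub i5 i6]
  rotate_left
  · exact i3.const_mul _
  · exact i4.const_mul _
  · exact i1.add i2
  · exact ((i3.const_mul _).add (i4.const_mul _)).const_mul _
  · exact (i1.add i2).add (((i3.const_mul _).add (i4.const_mul _)).const_mul _)
  · exact (i5.sub i6).const_mul _
  generalize (∫ z, h z * α z * D z ∂L) = I1 at *
  generalize (∫ z, h z * β z * D z ∂L) = I2 at *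
  generalize (∫ z, w z * (g z * β z) * D z ∂L) = I3 at *
  generalize (∫ z, w z * (g z * β z) * (g z * β z) ∂L) = I4 at *
  generalize (∫ z, e z * (g z * β z) * (h z * α z) ∂L) = I5 at *
  generalize (∫ z, e z * (g z * β z) * (h z * β z) ∂L) = I6 at *
  have p1 := Real.sqrt_nonneg (∫ z, (h z * α z) ^ 2 ∂L)
  have p2 := Real.sqrt_nonneg (∫ z, (h z * β z) ^ 2 ∂L)
  have p3 := Real.sqrt_nonneg (∫ z, (g z * β z) ^ 2 ∂L)
  have p4 := Real.sqrt_nonneg (∫ z, D z ^ 2 ∂L)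
  have p5 := Real.sqrt_nonneg (∫ z, (e z * (g z * β z)) ^ 2 ∂L)
  set a := √(∫ z, (h z * α z) ^ 2 ∂L)
  set b := √(∫ z, (h z * β z) ^ 2 ∂L)
  set c := √(∫ z, (g z * β z) ^ 2 ∂L)
  set d := √(∫ z, D z ^ 2 ∂L)
  set k := √(∫ z, (e z * (g z * β z)) ^ 2 ∂L)
  have q3 : |t * I3| ≤ t * (M * c * d) := by
    rw [abs_mul, abs_of_pos ht]
    exact mul_le_mul_of_nonneg_left (b3.trans (mul_le_mul_of_nonneg_right hwn p4)) ht.le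
  have q4 : |t * I4| ≤ t * (M * c * c) := by
    rw [abs_mul, abs_of_pos ht]
    exact mul_le_mul_of_nonneg_left (b4.trans (mul_le_mul_of_nonneg_right hwn p3)) ht.le
  have n3 : 0 ≤ t * (M * c * d) := by positivity
  have n4 : 0 ≤ t * (M * c * c) := by positivity
  have n5 : 0 ≤ k * a := by positivity
  have n6 : 0 ≤ k * b := by positivity
  rw [abs_le] at *
  constructor <;> nlinarith [b1.1, b1.2]

/-! ### Differentiating means along paths differentiable in quadratic mean -/

theorem sq_mul_sqrt_rnDeriv {Z : Type*} [MeasurableSpace Z] (P L : Measure Z) (u : Z → ℝ) (z : Z) :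
    (u z * √(P.rnDeriv L z).toReal) ^ 2 = (P.rnDeriv L z).toReal • u z ^ 2 := by
  rw [mul_pow, Real.sq_sqrt ENNReal.toReal_nonneg, smul_eq_mul, mul_comm]

theorem measurable_sqrt_rnDeriv {Z : Type*} [MeasurableSpace Z] (P L : Measure Z) :
    Measurable fun z => √(P.rnDeriv L z).toReal :=
  (Measure.measurable_rnDeriv P L).ennreal_toReal.sqrt

/-- Multiplication by the root density embeds L²(P) isometrically into L²(L), so that functions
square integrable under different laws can be compared in one space. -/
theorem memLp_two_mul_sqrt_rnDeriv {Z : Type*} [MeasurableSpace Z] {P L : Measure Z}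
    [IsFiniteMeasure P] [IsFiniteMeasure L] (hPL : P ≪ L) {u : Z → ℝ} (hum : Measurable u)
    (hu : MemLp u 2 P) : MemLp (fun z => u z * √(P.rnDeriv L z).toReal) 2 L := by
  have hm : AEStronglyMeasurable (fun z => u z * √(P.rnDeriv L z).toReal) L :=
    (hum.mul (measurable_sqrt_rnDeriv P L)).aestronglyMeasurable
  rw [memLp_two_iff_integrable_sq hm]
  simp_rw [sq_mul_sqrt_rnDeriv]
  exact (integrable_rnDeriv_smul_iff hPL).2 hu.integrable_sq

theorem integral_sq_mul_sqrt_rnDeriv {Z : Type*} [MeasurableSpace Z] {P L : Measure Z}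
    [IsFiniteMeasure P] [IsFiniteMeasure L] (hPL : P ≪ L) (u : Z → ℝ) :
    ∫ z, (u z * √(P.rnDeriv L z).toReal) ^ 2 ∂L = ∫ z, u z ^ 2 ∂P := by
  simp_rw [sq_mul_sqrt_rnDeriv]
  exact integral_rnDeriv_smul hPL

/-- The score enters only through its product with the root density of P₀, which vanishes where a
P₀-null change could matter. -/
theorem DifferentiableInQuadraticMean.congr_score {Z : Type*} [MeasurableSpace Z] {P₀ : Measure Z}
    [IsFiniteMeasure P₀] {P : ℝ → Measure Z} [∀ t, IsFiniteMeasure (P t)] {g g' : Z → ℝ}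
    (h : DifferentiableInQuadraticMean P₀ P g) (hgg' : g =ᵐ[P₀] g') :
    DifferentiableInQuadraticMean P₀ P g' := by
  refine h.congr fun t => lintegral_congr_ae ?_
  have hac : P₀ ≪ P₀ + P t := Measure.AbsolutelyContinuous.rfl.add_right _
  have h1 : ∀ᵐ z ∂(P₀ + P t).withDensity (P₀.rnDeriv (P₀ + P t)), g z = g' z := by
    rw [Measure.withDensity_rnDeriv_eq _ _ hac]
    exact hgg'
  rw [ae_withDensity_iff (Measure.measurable_rnDeriv _ _)] at h1
  filter_upwards [h1] with z hz
  by_cases h0 : P₀.rnDeriv (P₀ + P t) z = 0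
  · simp [h0]
  · rw [hz h0]

theorem tendsto_setIntegral_abs_gt {Z : Type*} [MeasurableSpace Z] {P : Measure Z}
    {h u : Z → ℝ} (hh : Measurable h) (hu : Integrable u P) :
    Tendsto (fun n : ℕ => ∫ z, {z | (n : ℝ) < |h z|}.indicator u z ∂P) atTop (𝓝 0) := by
  have := tendsto_integral_of_dominated_convergence (μ := P)
    (F := fun (n : ℕ) z => {z | (n : ℝ) < |h z|}.indicator u z) (f := fun _ => 0)
    (fun z => ‖u z‖) (fun n => hu.1.indicator (measurableSet_lt measurable_const hh.abs))
    hu.norm (fun n => ae_of_all _ fun z => norm_indicator_le_norm_self _ _)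
    (ae_of_all _ fun z => ?_)
  · simpa using this
  · refine tendsto_const_nhds.congr' ?_
    filter_upwards [tendsto_natCast_atTop_atTop.eventually_ge_atTop |h z|] with n hn
    exact (Set.indicator_of_notMem (by simpa using hn) _).symm

/-- Serves to take the limit in t first, at a fixed truncation level n, and then let n tend to
infinity. -/
theorem tendsto_zero_of_forall_eventually_le {ι : Type*} {l : Filter ι} {f : ι → ℝ}
    {b : ℕ → ι → ℝ} {c : ℕ → ℝ} (hf : ∀ n, ∀ᶠ i in l, |f i| ≤ b n i)
    (hb : ∀ n, Tendsto (b n) l (𝓝 (c n))) (hc : Tendsto c atTop (𝓝 0)) : Tendsto f l (𝓝 0) := by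
  rw [Metric.tendsto_nhds]
  intro ε hε
  obtain ⟨n, hn⟩ := (hc.eventually (gt_mem_nhds hε)).exists
  filter_upwards [hf n, (hb n).eventually (gt_mem_nhds hn)] with i h1 h2
  simpa using h1.trans_lt h2

/-- The derivative of the mean of `h` along a path that is differentiable in quadratic mean, when
the second moment of `h` stays bounded. -/
theorem DifferentiableInQuadraticMean.tendsto_integral {Z : Type*} [MeasurableSpace Z]
    {P₀ : Measure Z} [IsFiniteMeasure P₀] {P : ℝ → Measure Z} [∀ t, IsFiniteMeasure (P t)]
    {g h : Z → ℝ} (hd : DifferentiableInQuadraticMean P₀ P g) (hg : MemLp g 2 P₀)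
    (hh : Measurable h) {C : ℝ≥0} (hC₀ : ∫⁻ z, ENNReal.ofReal (h z ^ 2) ∂P₀ ≤ C)
    (hC : ∀ᶠ t in 𝓝[>] (0 : ℝ), ∫⁻ z, ENNReal.ofReal (h z ^ 2) ∂(P t) ≤ C) :
    Tendsto (fun t : ℝ => (∫ z, h z ∂(P t) - ∫ z, h z ∂P₀) / t) (𝓝[>] 0)
      (𝓝 (∫ z, h z * g z ∂P₀)) := by
  wlog hgm : Measurable g generalizing g
  · have hae := hg.1.ae_eq_mk
    have := this (hd.congr_score hae) (hg.ae_eq hae) hg.1.stronglyMeasurable_mk.measurable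
    have he : ∫ z, h z * hg.1.mk g z ∂P₀ = ∫ z, h z * g z ∂P₀ :=
      integral_congr_ae (hae.mono fun z hz => by simp only [hz])
    rwa [he] at this
  have hh2 : ∀ Q : Measure Z, ∫⁻ z, ENNReal.ofReal (h z ^ 2) ∂Q ≤ C → MemLp h 2 Q := fun Q hQ =>
    memLp_two_of_lintegral_sq_lt_top hh.aestronglyMeasurable (hQ.trans_lt ENNReal.coe_lt_top)
  have hC2 : ∀ Q : Measure Z, ∫⁻ z, ENNReal.ofReal (h z ^ 2) ∂Q ≤ C →
      √(∫ z, h z ^ 2 ∂Q) ≤ √C := fun Q hQ => by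
    rw [integral_sq_eq_toReal_lintegral hh.aestronglyMeasurable]
    exact Real.sqrt_le_sqrt (ENNReal.toReal_le_coe_of_le_coe hQ)
  set α : ℝ → Z → ℝ := fun t z => √((P t).rnDeriv (P₀ + P t) z).toReal with hα
  set β : ℝ → Z → ℝ := fun t z => √(P₀.rnDeriv (P₀ + P t) z).toReal with hβ
  set D : ℝ → Z → ℝ := fun t z => (α t z - β t z) / t - 1 / 2 * g z * β t z with hD
  have hαm : ∀ t, Measurable (α t) := fun t => measurable_sqrt_rnDeriv _ _
  have hβm : ∀ t, Measurable (β t) := fun t => measurable_sqrt_rnDeriv _ _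
  have hDm : ∀ t, Measurable (D t) := fun t =>
    (((hαm t).sub (hβm t)).div_const _).sub ((hgm.const_mul _).mul (hβm t))
  have hd' : Tendsto (fun t : ℝ => ∫⁻ z, ENNReal.ofReal (D t z ^ 2) ∂(P₀ + P t))
      (𝓝[>] 0) (𝓝 0) := hd
  have hD2 : Tendsto (fun t : ℝ => √(∫ z, D t z ^ 2 ∂(P₀ + P t))) (𝓝[>] 0) (𝓝 0) := by
    simp_rw [fun t => integral_sq_eq_toReal_lintegral (P := P₀ + P t)
      (hDm t).aestronglyMeasurable]
    simpa using ((ENNReal.tendsto_toReal ENNReal.zero_ne_top).comp hd').sqrt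
  set G := √(∫ z, g z ^ 2 ∂P₀) with hG
  have hac₀ : ∀ t, P₀ ≪ P₀ + P t := fun t => Measure.AbsolutelyContinuous.rfl.add_right _
  have hac : ∀ t, P t ≪ P₀ + P t := fun t => by
    rw [add_comm]; exact Measure.AbsolutelyContinuous.rfl.add_right _
  -- Of the three terms, the first vanishes as t ↓ 0 by differentiability in quadratic mean and the
  -- second by its factor t. The third does not depend on t and is small for large n, since g² is
  -- integrable.
  have hbound : ∀ n : ℕ, ∀ᶠ t in 𝓝[>] (0 : ℝ),
      |(∫ z, h z ∂(P t) - ∫ z, h z ∂P₀) / t - ∫ z, h z * g z ∂P₀|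
        ≤ (√C + √C) * √(∫ z, D t z ^ 2 ∂(P₀ + P t))
          + t * n * G * (√(∫ z, D t z ^ 2 ∂(P₀ + P t)) + G)
          + √(∫ z, {z | (n : ℝ) < |h z|}.indicator (fun z => g z ^ 2) z ∂P₀) * (√C + √C) := by
    intro n
    filter_upwards [hC, self_mem_nhdsWithin, hd'.eventually (gt_mem_nhds ENNReal.zero_lt_top)]
      with t ht ht0 hDt
    have ht0 : 0 < t := ht0
    have m1 := memLp_two_mul_sqrt_rnDeriv (hac t) hh (hh2 _ ht)
    have m2 := memLp_two_mul_sqrt_rnDeriv (hac₀ t) hh (hh2 _ hC₀)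
    have m3 := memLp_two_mul_sqrt_rnDeriv (hac₀ t) hgm hg
    have m4 : MemLp (D t) 2 (P₀ + P t) :=
      memLp_two_of_lintegral_sq_lt_top (hDm t).aestronglyMeasurable hDt
    have key := abs_integral_mul_sq_sub_sq_le hh m1 m2 m3 ht0 m4 (Nat.cast_nonneg n)
    rw [integral_sq_mul_sqrt_rnDeriv (hac t), integral_sq_mul_sqrt_rnDeriv (hac₀ t),
      integral_sq_mul_sqrt_rnDeriv (hac₀ t)] at key
    simp_rw [← mul_assoc] at key
    rw [integral_sq_mul_sqrt_rnDeriv (hac₀ t)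
      (fun z => {z | (n : ℝ) < |h z|}.indicator (fun _ => 1) z * g z)] at key
    have e1 : ∀ z, ({z | (n : ℝ) < |h z|}.indicator (fun _ => 1) z * g z) ^ 2
        = {z | (n : ℝ) < |h z|}.indicator (fun z => g z ^ 2) z := fun z => by
      by_cases hz : (n : ℝ) < |h z| <;> simp [Set.indicator, hz]
    simp_rw [e1] at key
    have i1 : Integrable (fun z => h z * √((P t).rnDeriv (P₀ + P t) z).toReal ^ 2) (P₀ + P t) := by
      simp_rw [Real.sq_sqrt ENNReal.toReal_nonneg, mul_comm (h _)]
      exact (integrable_rnDeriv_smul_iff (hac t)).2 ((hh2 _ ht).integrable one_le_two)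
    have i2 : Integrable (fun z => h z * √(P₀.rnDeriv (P₀ + P t) z).toReal ^ 2) (P₀ + P t) := by
      simp_rw [Real.sq_sqrt ENNReal.toReal_nonneg, mul_comm (h _)]
      exact (integrable_rnDeriv_smul_iff (hac₀ t)).2 ((hh2 _ hC₀).integrable one_le_two)
    have i3 : Integrable (fun z => h z * g z * √(P₀.rnDeriv (P₀ + P t) z).toReal ^ 2)
        (P₀ + P t) := by
      simp_rw [Real.sq_sqrt ENNReal.toReal_nonneg, mul_comm (h _ * _)]
      exact (integrable_rnDeriv_smul_iff (hac₀ t)).2 ((hh2 _ hC₀).integrable_mul hg)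
    rw [integral_sub (by exact (i1.sub i2).div_const t) i3, integral_div, integral_sub i1 i2] at key
    have r : ∀ (Q : Measure Z) [IsFiniteMeasure Q] (u : Z → ℝ), Q ≪ P₀ + P t →
        ∫ z, u z * √(Q.rnDeriv (P₀ + P t) z).toReal ^ 2 ∂(P₀ + P t) = ∫ z, u z ∂Q := by
      intro Q _ u hQ
      simp_rw [Real.sq_sqrt ENNReal.toReal_nonneg, mul_comm (u _)]
      exact integral_rnDeriv_smul hQ
    rw [r _ _ (hac t), r _ _ (hac₀ t), r P₀ (fun z => h z * g z) (hac₀ t)] at key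
    refine key.trans ?_
    have c1 := hC2 _ ht
    have c2 := hC2 _ hC₀
    gcongr
  rw [← tendsto_sub_nhds_zero_iff]
  refine tendsto_zero_of_forall_eventually_le
    (c := fun n : ℕ => √(∫ z, {z | (n : ℝ) < |h z|}.indicator (fun z => g z ^ 2) z ∂P₀)
      * (√C + √C)) hbound (fun n => ?_) ?_
  · have ht : Tendsto (fun t : ℝ => t) (𝓝[>] 0) (𝓝 0) := tendsto_nhdsWithin_of_tendsto_nhds tendsto_id
    have := (((hD2.const_mul (√C + √C)).add
      (((ht.mul_const (n : ℝ)).mul_const G).mul (hD2.add_const G))).add_const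
      (√(∫ z, {z | (n : ℝ) < |h z|}.indicator (fun z => g z ^ 2) z ∂P₀) * (√C + √C)))
    simpa using this
  · simpa using ((tendsto_setIntegral_abs_gt hh hg.integrable_sq).sqrt).mul_const (√C + √C)

/-! ### Linear perturbations with bounded score -/

/-- With s = √(1 + u) the left side is (s - 1)² / 2, while u² = (s - 1)² (s + 1)² and s + 1 ≥ 1. -/
theorem abs_sqrt_one_add_sub_le {u : ℝ} (hu : -1 ≤ u) : |√(1 + u) - 1 - u / 2| ≤ u ^ 2 / 2 := by
  have h0 := Real.sqrt_nonneg (1 + u)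
  have h1 := Real.sq_sqrt (show 0 ≤ 1 + u by linarith)
  set s := √(1 + u)
  have e1 : u = s ^ 2 - 1 := by linarith
  rw [e1, abs_le]
  constructor <;> nlinarith [sq_nonneg (s - 1), sq_nonneg (s + 1), mul_nonneg h0 (sq_nonneg (s - 1)),
    mul_nonneg (mul_nonneg h0 h0) (sq_nonneg (s - 1))]

/-- A linear perturbation of a measure in the direction of a bounded score is differentiable in
quadratic mean. -/
theorem differentiableInQuadraticMean_withDensity {Z : Type*} [MeasurableSpace Z]
    {P₀ : Measure Z} [IsFiniteMeasure P₀] {P : ℝ → Measure Z} [∀ t, IsFiniteMeasure (P t)]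
    {g : Z → ℝ} (hg : Measurable g) {M : ℝ} (hM : ∀ z, |g z| ≤ M)
    (hP : ∀ᶠ t in 𝓝[>] (0 : ℝ), P t = P₀.withDensity fun z => ENNReal.ofReal (1 + t * g z)) :
    DifferentiableInQuadraticMean P₀ P g := by
  rcases isEmpty_or_nonempty Z with hZ | ⟨⟨z₀⟩⟩
  · simp [DifferentiableInQuadraticMean, lintegral_of_isEmpty]
  have hM0 : 0 ≤ M := (abs_nonneg _).trans (hM z₀)
  have hle : ∀ᶠ t in 𝓝[>] (0 : ℝ), t * M ≤ 1 := by
    have : Tendsto (fun t : ℝ => t * M) (𝓝[>] 0) (𝓝 0) := by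
      simpa using (tendsto_nhdsWithin_of_tendsto_nhds (tendsto_id (x := 𝓝 (0 : ℝ)))).mul_const M
    exact this.eventually (ge_mem_nhds one_pos)
  have hlim : Tendsto (fun t : ℝ => ENNReal.ofReal ((t * M ^ 2 / 2) ^ 2) * P₀ Set.univ)
      (𝓝[>] 0) (𝓝 0) := by
    have h1 : Tendsto (fun t : ℝ => (t * M ^ 2 / 2) ^ 2) (𝓝[>] 0) (𝓝 0) := by
      have : ContinuousAt (fun t : ℝ => (t * M ^ 2 / 2) ^ 2) 0 := by fun_prop
      simpa [ContinuousAt] using this.tendsto.mono_left nhdsWithin_le_nhds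
    simpa using ENNReal.Tendsto.mul_const (ENNReal.tendsto_ofReal h1)
      (Or.inr (measure_ne_top P₀ Set.univ))
  refine tendsto_of_tendsto_of_tendsto_of_le_of_le' tendsto_const_nhds hlim
    (Eventually.of_forall fun _ => zero_le) ?_
  filter_upwards [hP, hle, self_mem_nhdsWithin] with t ht htM ht0
  have ht0 : 0 < t := ht0
  have hac : P₀ ≪ P₀ + P t := Measure.AbsolutelyContinuous.rfl.add_right _
  have hfm : Measurable fun z => ENNReal.ofReal (1 + t * g z) :=
    (measurable_const.add (hg.const_mul t)).ennreal_ofReal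
  -- The density of P t is 1 + t g times that of P₀, so √(dP₀) factors out of the integrand and the
  -- rest is the Taylor remainder of √(1 + t g), divided by t.
  have hr : (P t).rnDeriv (P₀ + P t)
      =ᵐ[P₀ + P t] fun z => ENNReal.ofReal (1 + t * g z) * P₀.rnDeriv (P₀ + P t) z := by
    have := Measure.rnDeriv_withDensity_left_of_absolutelyContinuous hac hfm.aemeasurable
    rwa [← ht] at this
  calc _ ≤ ∫⁻ z, ENNReal.ofReal ((t * M ^ 2 / 2) ^ 2) * P₀.rnDeriv (P₀ + P t) z ∂(P₀ + P t) := by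
        refine lintegral_mono_ae ?_
        filter_upwards [hr, Measure.rnDeriv_lt_top P₀ (P₀ + P t)] with z hz hfin
        have hgz := abs_le.1 (hM z)
        have hu : -1 ≤ t * g z := by nlinarith [mul_le_mul_of_nonneg_left hgz.1 ht0.le]
        rw [hz, ENNReal.toReal_mul, ENNReal.toReal_ofReal (by linarith),
          Real.sqrt_mul (by linarith)]
        conv_rhs => rw [← ENNReal.ofReal_toReal hfin.ne]
        rw [← ENNReal.ofReal_mul (sq_nonneg _)]
        refine ENNReal.ofReal_le_ofReal ?_
        set r := (P₀.rnDeriv (P₀ + P t) z).toReal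
        have hb : |(√(1 + t * g z) - 1 - t * g z / 2) / t| ≤ t * M ^ 2 / 2 := by
          rw [abs_div, abs_of_pos ht0, div_le_iff₀ ht0]
          refine (abs_sqrt_one_add_sub_le hu).trans ?_
          have : g z ^ 2 ≤ M ^ 2 := sq_le_sq' hgz.1 hgz.2
          nlinarith [mul_le_mul_of_nonneg_left this (sq_nonneg t)]
        have e : (√(1 + t * g z) * √r - √r) / t - 1 / 2 * g z * √r
            = (√(1 + t * g z) - 1 - t * g z / 2) / t * √r := by
          field_simp
        rw [e, mul_pow, Real.sq_sqrt ENNReal.toReal_nonneg]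
        exact mul_le_mul_of_nonneg_right (sq_le_sq' (neg_le_of_abs_le hb) (le_of_abs_le hb))
          ENNReal.toReal_nonneg
    _ = ENNReal.ofReal ((t * M ^ 2 / 2) ^ 2) * P₀ Set.univ := by
        rw [lintegral_const_mul _ (Measure.measurable_rnDeriv _ _), Measure.lintegral_rnDeriv hac]

/-! ### Integrals under the observed, sampling and population laws -/

namespace Experiment

variable {𝒳 𝒲 : Type*} [MeasurableSpace 𝒳] [MeasurableSpace 𝒲]

instance isProbabilityMeasure_withDensity_p (E : Experiment 𝒳 𝒲) :
    IsProbabilityMeasure (E.ν.withDensity fun x => ENNReal.ofReal (E.p x)) :=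
  ⟨by simpa using E.lintegral_p⟩

instance isProbabilityMeasure_withDensity_q (E : Experiment 𝒳 𝒲) :
    IsProbabilityMeasure (E.ν.withDensity fun x => ENNReal.ofReal (E.q x)) :=
  ⟨by simpa using E.lintegral_q⟩

instance isProbabilityMeasure_samplingLaw (E : Experiment 𝒳 𝒲) (κ : Kernel 𝒳 (𝒲 × ℝ))
    [IsMarkovKernel κ] : IsProbabilityMeasure (E.samplingLaw κ) := by
  unfold samplingLaw; infer_instance

instance isProbabilityMeasure_populationLaw (E : Experiment 𝒳 𝒲) (κ : Kernel 𝒳 (𝒲 × ℝ))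
    [IsMarkovKernel κ] : IsProbabilityMeasure (E.populationLaw κ) := by
  unfold populationLaw; infer_instance

theorem measurable_prediction (E : Experiment 𝒳 𝒲) :
    Measurable fun u : 𝒳 × 𝒲 × ℝ => E.f u.1 u.2.1 :=
  E.measurable_f.comp (measurable_fst.prodMk measurable_snd.fst)

/-- The part `(X, F, Y)` of the full data on which the observation depends. -/
def complete (E : Experiment 𝒳 𝒲) (u : 𝒳 × 𝒲 × ℝ) : 𝒳 × ℝ × ℝ :=
  (u.1, E.f u.1 u.2.1, u.2.2)

theorem measurable_complete (E : Experiment 𝒳 𝒲) : Measurable E.complete :=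
  measurable_fst.prodMk (E.measurable_prediction.prodMk measurable_snd.snd)

theorem measurable_treated (E : Experiment 𝒳 𝒲) :
    Measurable fun u : 𝒳 × 𝒲 × ℝ => ((u.1, E.f u.1 u.2.1, 1, u.2.2) : 𝒳 × ℝ × ℝ × ℝ) :=
  measurable_fst.prodMk (E.measurable_prediction.prodMk (measurable_const.prodMk measurable_snd.snd))

theorem measurable_untreated (E : Experiment 𝒳 𝒲) :
    Measurable fun u : 𝒳 × 𝒲 × ℝ => ((u.1, E.f u.1 u.2.1, 0, 0) : 𝒳 × ℝ × ℝ × ℝ) :=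
  measurable_fst.prodMk (E.measurable_prediction.prodMk measurable_const)

/-- Splitting by the value of Δ turns every integral over Z into one over (X, W, Y); on the part Δ =
0 the outcome has disappeared. -/
theorem observedLaw_eq (E : Experiment 𝒳 𝒲) (κ : Kernel 𝒳 (𝒲 × ℝ)) :
    E.observedLaw κ
      = ((E.samplingLaw κ).withDensity fun u => ENNReal.ofReal (E.π u.1)).map
          (fun u => (u.1, E.f u.1 u.2.1, 1, u.2.2))
        + ((E.samplingLaw κ).withDensity fun u => ENNReal.ofReal (1 - E.π u.1)).map
          (fun u => (u.1, E.f u.1 u.2.1, 0, 0)) := by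
  have hobs : Measurable E.observe := by
    refine (measurable_fst.fst).prodMk ((E.measurable_prediction.comp measurable_fst).prodMk
      (measurable_snd.prodMk (measurable_snd.mul measurable_fst.snd.snd)))
  unfold observedLaw fullDataLaw
  rw [Measure.map_add _ _ hobs, Measure.map_map hobs (by fun_prop),
    Measure.map_map hobs (by fun_prop)]
  congr 2 <;> ext u <;> simp [observe]

theorem measurable_π_fst (E : Experiment 𝒳 𝒲) :
    Measurable fun u : 𝒳 × 𝒲 × ℝ => E.π u.1 := E.measurable_π.comp measurable_fst

theorem lintegral_observedLaw (E : Experiment 𝒳 𝒲) (κ : Kernel 𝒳 (𝒲 × ℝ))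
    {G : 𝒳 × ℝ × ℝ × ℝ → ℝ≥0∞} (hG : Measurable G) :
    ∫⁻ z, G z ∂(E.observedLaw κ)
      = ∫⁻ u, (ENNReal.ofReal (E.π u.1) * G (u.1, E.f u.1 u.2.1, 1, u.2.2)
          + ENNReal.ofReal (1 - E.π u.1) * G (u.1, E.f u.1 u.2.1, 0, 0)) ∂(E.samplingLaw κ) := by
  have h1 : Measurable fun u : 𝒳 × 𝒲 × ℝ => G (u.1, E.f u.1 u.2.1, 1, u.2.2) :=
    hG.comp E.measurable_treated
  have h0 : Measurable fun u : 𝒳 × 𝒲 × ℝ => G (u.1, E.f u.1 u.2.1, 0, 0) :=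
    hG.comp E.measurable_untreated
  rw [observedLaw_eq, lintegral_add_measure, lintegral_map hG E.measurable_treated,
    lintegral_map hG E.measurable_untreated,
    lintegral_withDensity_eq_lintegral_mul _ E.measurable_π_fst.ennreal_ofReal h1,
    lintegral_withDensity_eq_lintegral_mul _
      (E.measurable_π_fst.const_sub 1).ennreal_ofReal h0,
    ← lintegral_add_left (E.measurable_π_fst.ennreal_ofReal.mul h1)]
  rfl

instance isProbabilityMeasure_observedLaw (E : Experiment 𝒳 𝒲) (κ : Kernel 𝒳 (𝒲 × ℝ))
    [IsMarkovKernel κ] : IsProbabilityMeasure (E.observedLaw κ) := by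
  constructor
  have h := E.lintegral_observedLaw κ (measurable_const (a := (1 : ℝ≥0∞)))
  simp only [lintegral_one, mul_one] at h
  rw [h]
  have : ∀ u : 𝒳 × 𝒲 × ℝ, ENNReal.ofReal (E.π u.1) + ENNReal.ofReal (1 - E.π u.1) = 1 := fun u => by
    rw [← ENNReal.ofReal_add (E.π_nonneg _) (sub_nonneg.2 (E.π_le_one _))]
    simp
  simp [this]

theorem integrable_observedLaw_iff (E : Experiment 𝒳 𝒲) (κ : Kernel 𝒳 (𝒲 × ℝ))
    {G : 𝒳 × ℝ × ℝ × ℝ → ℝ} (hG : Measurable G) :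
    Integrable G (E.observedLaw κ)
      ↔ Integrable (fun u => E.π u.1 * G (u.1, E.f u.1 u.2.1, 1, u.2.2)) (E.samplingLaw κ)
        ∧ Integrable (fun u => (1 - E.π u.1) * G (u.1, E.f u.1 u.2.1, 0, 0))
          (E.samplingLaw κ) := by
  rw [observedLaw_eq, integrable_add_measure,
    integrable_map_measure hG.aestronglyMeasurable E.measurable_treated.aemeasurable,
    integrable_map_measure hG.aestronglyMeasurable E.measurable_untreated.aemeasurable,
    integrable_withDensity_iff_integrable_smul' E.measurable_π_fst.ennreal_ofReal
      (ae_of_all _ fun _ => ENNReal.ofReal_lt_top),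
    integrable_withDensity_iff_integrable_smul' (E.measurable_π_fst.const_sub 1).ennreal_ofReal
      (ae_of_all _ fun _ => ENNReal.ofReal_lt_top)]
  simp only [ENNReal.toReal_ofReal (E.π_nonneg _),
    ENNReal.toReal_ofReal (sub_nonneg.2 (E.π_le_one _)), smul_eq_mul, Function.comp_apply]

theorem integral_observedLaw (E : Experiment 𝒳 𝒲) (κ : Kernel 𝒳 (𝒲 × ℝ))
    {G : 𝒳 × ℝ × ℝ × ℝ → ℝ} (hG : Measurable G) (hGi : Integrable G (E.observedLaw κ)) :
    ∫ z, G z ∂(E.observedLaw κ)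
      = ∫ u, E.π u.1 * G (u.1, E.f u.1 u.2.1, 1, u.2.2) ∂(E.samplingLaw κ)
        + ∫ u, (1 - E.π u.1) * G (u.1, E.f u.1 u.2.1, 0, 0) ∂(E.samplingLaw κ) := by
  rw [observedLaw_eq] at hGi ⊢
  rw [integral_add_measure (integrable_add_measure.1 hGi).1 (integrable_add_measure.1 hGi).2,
    integral_map E.measurable_treated.aemeasurable hG.aestronglyMeasurable,
    integral_map E.measurable_untreated.aemeasurable hG.aestronglyMeasurable,
    integral_withDensity_eq_integral_toReal_smul E.measurable_π_fst.ennreal_ofReal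
      (ae_of_all _ fun _ => ENNReal.ofReal_lt_top),
    integral_withDensity_eq_integral_toReal_smul (E.measurable_π_fst.const_sub 1).ennreal_ofReal
      (ae_of_all _ fun _ => ENNReal.ofReal_lt_top)]
  simp only [ENNReal.toReal_ofReal (E.π_nonneg _),
    ENNReal.toReal_ofReal (sub_nonneg.2 (E.π_le_one _)), smul_eq_mul]

/-- A property that holds almost everywhere for the reference measure holds almost surely for the
sampled covariate. -/
theorem ae_samplingLaw_of_ae (E : Experiment 𝒳 𝒲) (κ : Kernel 𝒳 (𝒲 × ℝ)) [IsMarkovKernel κ]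
    {P : 𝒳 → Prop} (h : ∀ᵐ x ∂E.ν, P x) : ∀ᵐ u ∂(E.samplingLaw κ), P u.1 := by
  refine ae_of_ae_map (f := Prod.fst) measurable_fst.aemeasurable ?_
  have : (E.samplingLaw κ).map Prod.fst = E.ν.withDensity fun x => ENNReal.ofReal (E.p x) :=
    Measure.fst_compProd _ _
  rw [this]
  exact (withDensity_absolutelyContinuous _ _).ae_le h

theorem measurable_q_div_p_fst (E : Experiment 𝒳 𝒲) :
    Measurable fun u : 𝒳 × 𝒲 × ℝ => E.q u.1 / E.p u.1 :=
  (E.measurable_q.div E.measurable_p).comp measurable_fst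

theorem q_div_p_nonneg (E : Experiment 𝒳 𝒲) (x : 𝒳) : 0 ≤ E.q x / E.p x :=
  div_nonneg (E.q_nonneg x) (E.p_nonneg x)

/-- Reweighting by `q / p` turns the sampling law into the population law. -/
theorem populationLaw_eq_withDensity (E : Experiment 𝒳 𝒲)
    (overlap : ∀ᵐ x ∂E.ν, 0 < E.q x → 0 < E.p x ∧ 0 < E.π x)
    (κ : Kernel 𝒳 (𝒲 × ℝ)) [IsMarkovKernel κ] :
    E.populationLaw κ
      = (E.samplingLaw κ).withDensity fun u => ENNReal.ofReal (E.q u.1 / E.p u.1) := by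
  have hr : Measurable fun x => ENNReal.ofReal (E.q x / E.p x) :=
    (E.measurable_q.div E.measurable_p).ennreal_ofReal
  have hq : (E.ν.withDensity fun x => ENNReal.ofReal (E.q x))
      = (E.ν.withDensity fun x => ENNReal.ofReal (E.p x)).withDensity
          fun x => ENNReal.ofReal (E.q x / E.p x) := by
    rw [← withDensity_mul _ E.measurable_p.ennreal_ofReal hr]
    refine withDensity_congr_ae ?_
    filter_upwards [overlap] with x hx
    rw [Pi.mul_apply, ← ENNReal.ofReal_mul (E.p_nonneg x)]
    rcases (E.q_nonneg x).eq_or_lt with h | h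
    · simp [← h]
    · rw [mul_div_cancel₀ _ (hx h).1.ne']
  unfold populationLaw samplingLaw
  have hfin : IsFiniteMeasure ((E.ν.withDensity fun x => ENNReal.ofReal (E.p x)).withDensity
      fun x => ENNReal.ofReal (E.q x / E.p x)) := by rw [← hq]; infer_instance
  rw [hq]
  refine Measure.ext_of_lintegral _ fun G hG => ?_
  rw [Measure.lintegral_compProd hG, lintegral_withDensity_eq_lintegral_mul _ hr
    hG.lintegral_kernel_prod_right', lintegral_withDensity_eq_lintegral_mul _
    E.measurable_q_div_p_fst.ennreal_ofReal hG, Measure.lintegral_compProd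
    (E.measurable_q_div_p_fst.ennreal_ofReal.mul hG)]
  refine lintegral_congr fun x => ?_
  exact (lintegral_const_mul _ (hG.comp measurable_prodMk_left)).symm

theorem lintegral_populationLaw (E : Experiment 𝒳 𝒲)
    (overlap : ∀ᵐ x ∂E.ν, 0 < E.q x → 0 < E.p x ∧ 0 < E.π x)
    (κ : Kernel 𝒳 (𝒲 × ℝ)) [IsMarkovKernel κ] {G : 𝒳 × 𝒲 × ℝ → ℝ≥0∞} (hG : Measurable G) :
    ∫⁻ u, G u ∂(E.populationLaw κ)
      = ∫⁻ u, ENNReal.ofReal (E.q u.1 / E.p u.1) * G u ∂(E.samplingLaw κ) := by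
  rw [E.populationLaw_eq_withDensity overlap, lintegral_withDensity_eq_lintegral_mul _
    E.measurable_q_div_p_fst.ennreal_ofReal hG]
  rfl

theorem integral_populationLaw (E : Experiment 𝒳 𝒲)
    (overlap : ∀ᵐ x ∂E.ν, 0 < E.q x → 0 < E.p x ∧ 0 < E.π x)
    (κ : Kernel 𝒳 (𝒲 × ℝ)) [IsMarkovKernel κ] (G : 𝒳 × 𝒲 × ℝ → ℝ) :
    ∫ u, G u ∂(E.populationLaw κ) = ∫ u, E.q u.1 / E.p u.1 * G u ∂(E.samplingLaw κ) := by
  rw [E.populationLaw_eq_withDensity overlap,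
    integral_withDensity_eq_integral_toReal_smul E.measurable_q_div_p_fst.ennreal_ofReal
      (ae_of_all _ fun _ => ENNReal.ofReal_lt_top)]
  simp only [ENNReal.toReal_ofReal (E.q_div_p_nonneg _), smul_eq_mul]

theorem integrable_populationLaw_iff (E : Experiment 𝒳 𝒲)
    (overlap : ∀ᵐ x ∂E.ν, 0 < E.q x → 0 < E.p x ∧ 0 < E.π x)
    (κ : Kernel 𝒳 (𝒲 × ℝ)) [IsMarkovKernel κ] {G : 𝒳 × 𝒲 × ℝ → ℝ} :
    Integrable G (E.populationLaw κ)
      ↔ Integrable (fun u => E.q u.1 / E.p u.1 * G u) (E.samplingLaw κ) := by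
  rw [E.populationLaw_eq_withDensity overlap,
    integrable_withDensity_iff_integrable_smul' E.measurable_q_div_p_fst.ennreal_ofReal
      (ae_of_all _ fun _ => ENNReal.ofReal_lt_top)]
  simp only [ENNReal.toReal_ofReal (E.q_div_p_nonneg _), smul_eq_mul]

/-! ### Regressions and their orthogonality relations -/

theorem measurable_integral_outcome (κ : Kernel 𝒳 (𝒲 × ℝ)) [IsMarkovKernel κ] :
    Measurable fun x => ∫ v, v.2 ∂(κ x) :=
  (measurable_snd.stronglyMeasurable.integral_kernel (κ := κ)).measurable

/-- The outcome regression is the mean of the kernel wherever the population density is positive. -/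
theorem IsOutcomeRegression.ae_eq_integral {E : Experiment 𝒳 𝒲} {κ : Kernel 𝒳 (𝒲 × ℝ)}
    (hκ : E.InModel κ) {μ : 𝒳 → ℝ} (hμ : E.IsOutcomeRegression κ μ) :
    ∀ᵐ x ∂E.ν, 0 < E.q x → μ x = ∫ v, v.2 ∂(κ x) := by
  have := hκ.isMarkovKernel
  have hint : Integrable (fun u : 𝒳 × 𝒲 × ℝ => u.2.2)
    ((E.ν.withDensity fun x => ENNReal.ofReal (E.q x)) ⊗ₘ κ) := hκ.integrable
  have hmap : (E.populationLaw κ).map Prod.fst = E.ν.withDensity fun x => ENNReal.ofReal (E.q x) :=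
    Measure.fst_compProd _ _
  have hmm := measurable_integral_outcome κ
  have h0 : Integrable (fun x => ∫ v, v.2 ∂(κ x)) (E.ν.withDensity fun x => ENNReal.ofReal (E.q x)) :=
    -- The composition of a measure with a kernel is a composition of kernels indexed by a one-point
    -- space.
    Integrable.integral_compProd (κ := Kernel.const Unit _) (η := Kernel.prodMkLeft Unit κ) (a := ())
      hint
  have h1 : Integrable (fun u : 𝒳 × 𝒲 × ℝ => ∫ v, v.2 ∂(κ u.1)) (E.populationLaw κ) := by
    rw [← hmap] at h0
    exact h0.comp_measurable measurable_fst
  have hm : MeasurableSpace.comap (fun u : 𝒳 × 𝒲 × ℝ => u.1) inferInstance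
      ≤ (inferInstance : MeasurableSpace (𝒳 × 𝒲 × ℝ)) := measurable_fst.comap_le
  have h2 : (fun u : 𝒳 × 𝒲 × ℝ => ∫ v, v.2 ∂(κ u.1)) =ᵐ[E.populationLaw κ]
      (E.populationLaw κ)[fun u => u.2.2 |
        MeasurableSpace.comap (fun u : 𝒳 × 𝒲 × ℝ => u.1) inferInstance] := by
    refine ae_eq_condExp_of_forall_setIntegral_eq hm hκ.integrable
      (fun s _ _ => h1.integrableOn) ?_ ?_
    · rintro s ⟨B, hB, rfl⟩ -
      have hs : (fun u : 𝒳 × 𝒲 × ℝ => u.1) ⁻¹' B = B ×ˢ Set.univ := by ext; simp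
      rw [hs, populationLaw, Measure.setIntegral_compProd hB MeasurableSet.univ h1.integrableOn,
        Measure.setIntegral_compProd hB MeasurableSet.univ hint.integrableOn]
      simp
    · exact (hmm.comp (comap_measurable _)).aestronglyMeasurable
  have h3 : ∀ᵐ x ∂(E.ν.withDensity fun x => ENNReal.ofReal (E.q x)), μ x = ∫ v, v.2 ∂(κ x) := by
    rw [← hmap, ae_map_iff measurable_fst.aemeasurable (measurableSet_eq_fun hμ.1 hmm)]
    exact hμ.2.trans h2.symm
  rw [ae_withDensity_iff E.measurable_q.ennreal_ofReal] at h3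
  filter_upwards [h3] with x hx hq
  exact hx (by simpa using hq)

theorem integrable_regression {E : Experiment 𝒳 𝒲} {κ : Kernel 𝒳 (𝒲 × ℝ)}
    {μ : 𝒳 → ℝ} (hμ : E.IsOutcomeRegression κ μ) :
    Integrable (fun u => μ u.1) (E.populationLaw κ) :=
  integrable_condExp.congr hμ.2.symm

theorem integrable_predictionRegression {E : Experiment 𝒳 𝒲} {κ : Kernel 𝒳 (𝒲 × ℝ)}
    {τ : 𝒳 → ℝ → ℝ} (hτ : E.IsPredictionRegression κ τ) :
    Integrable (fun u => τ u.1 (E.f u.1 u.2.1)) (E.populationLaw κ) :=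
  integrable_condExp.congr hτ.2.symm

theorem comap_prediction_le (E : Experiment 𝒳 𝒲) :
    MeasurableSpace.comap (fun u : 𝒳 × 𝒲 × ℝ => (u.1, E.f u.1 u.2.1)) inferInstance
      ≤ (inferInstance : MeasurableSpace (𝒳 × 𝒲 × ℝ)) :=
  (measurable_fst.prodMk E.measurable_prediction).comap_le

theorem stronglyMeasurable_comap_prediction (E : Experiment 𝒳 𝒲) {w : 𝒳 × ℝ → ℝ}
    (hw : Measurable w) :
    StronglyMeasurable[MeasurableSpace.comap
      (fun u : 𝒳 × 𝒲 × ℝ => (u.1, E.f u.1 u.2.1)) inferInstance]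
      (fun u : 𝒳 × 𝒲 × ℝ => w (u.1, E.f u.1 u.2.1)) :=
  (hw.comp (comap_measurable _)).stronglyMeasurable

/-- The residual of the outcome is orthogonal to every function of `(X, F)`. -/
theorem integral_mul_sub_predictionRegression_eq_zero {E : Experiment 𝒳 𝒲}
    {κ : Kernel 𝒳 (𝒲 × ℝ)} (hκ : E.InModel κ) {τ : 𝒳 → ℝ → ℝ}
    (hτ : E.IsPredictionRegression κ τ) {w : 𝒳 × ℝ → ℝ} (hw : Measurable w)
    (hi : Integrable (fun u => w (u.1, E.f u.1 u.2.1) * (u.2.2 - τ u.1 (E.f u.1 u.2.1)))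
      (E.populationLaw κ)) :
    ∫ u, w (u.1, E.f u.1 u.2.1) * (u.2.2 - τ u.1 (E.f u.1 u.2.1)) ∂(E.populationLaw κ) = 0 := by
  have := hκ.isMarkovKernel
  have hτi := integrable_predictionRegression hτ
  have hsub : Integrable (fun u : 𝒳 × 𝒲 × ℝ => u.2.2 - τ u.1 (E.f u.1 u.2.1))
    (E.populationLaw κ) := hκ.integrable.sub hτi
  have h1 := condExp_mul_of_stronglyMeasurable_left
    (E.stronglyMeasurable_comap_prediction hw) hi hsub
  have h2 := condExp_sub hκ.integrable hτi
    (MeasurableSpace.comap (fun u : 𝒳 × 𝒲 × ℝ => (u.1, E.f u.1 u.2.1)) inferInstance)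
  have h3 := condExp_of_stronglyMeasurable E.comap_prediction_le
    (E.stronglyMeasurable_comap_prediction hτ.1) hτi
  rw [← integral_condExp E.comap_prediction_le]
  refine integral_eq_zero_of_ae ?_
  filter_upwards [h1, h2, hτ.2] with u e1 e2 e3
  have e4 := congrFun h3 u
  simp only [Pi.mul_apply, Pi.sub_apply, Pi.zero_apply, Function.uncurry] at e1 e2 e4 ⊢
  refine e1.trans (mul_eq_zero_of_right _ ?_)
  refine e2.trans ?_
  rw [← e3]
  exact sub_eq_zero.2 e4.symm

/-- The difference of the two regressions is orthogonal to every function of `X`. -/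
theorem integral_mul_regression_sub_eq_zero {E : Experiment 𝒳 𝒲}
    {κ : Kernel 𝒳 (𝒲 × ℝ)} (hκ : E.InModel κ) {μ : 𝒳 → ℝ} (hμ : E.IsOutcomeRegression κ μ)
    {τ : 𝒳 → ℝ → ℝ} (hτ : E.IsPredictionRegression κ τ) {c : 𝒳 → ℝ} (hc : Measurable c)
    (hi : Integrable (fun u => c u.1 * (τ u.1 (E.f u.1 u.2.1) - μ u.1)) (E.populationLaw κ)) :
    ∫ u, c u.1 * (τ u.1 (E.f u.1 u.2.1) - μ u.1) ∂(E.populationLaw κ) = 0 := by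
  have := hκ.isMarkovKernel
  have hμi := integrable_regression hμ
  have hτi := integrable_predictionRegression hτ
  have hm : MeasurableSpace.comap (fun u : 𝒳 × 𝒲 × ℝ => u.1) inferInstance
      ≤ (inferInstance : MeasurableSpace (𝒳 × 𝒲 × ℝ)) := measurable_fst.comap_le
  have hm' : MeasurableSpace.comap (fun u : 𝒳 × 𝒲 × ℝ => u.1) inferInstance
      ≤ MeasurableSpace.comap (fun u : 𝒳 × 𝒲 × ℝ => (u.1, E.f u.1 u.2.1)) inferInstance :=
    (measurable_fst.comp (comap_measurable
      fun u : 𝒳 × 𝒲 × ℝ => (u.1, E.f u.1 u.2.1))).comap_le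
  have hsub : Integrable (fun u : 𝒳 × 𝒲 × ℝ => τ u.1 (E.f u.1 u.2.1) - μ u.1)
    (E.populationLaw κ) := hτi.sub hμi
  have h1 := condExp_mul_of_stronglyMeasurable_left (μ := E.populationLaw κ)
    (hc.comp (comap_measurable (fun u : 𝒳 × 𝒲 × ℝ => u.1))).stronglyMeasurable hi hsub
  have h2 := condExp_sub hτi hμi
    (MeasurableSpace.comap (fun u : 𝒳 × 𝒲 × ℝ => u.1) inferInstance)
  have h3 := condExp_of_stronglyMeasurable hm
    (hμ.1.comp (comap_measurable (fun u : 𝒳 × 𝒲 × ℝ => u.1))).stronglyMeasurable hμi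
  have h4 := (condExp_congr_ae (m := MeasurableSpace.comap (fun u : 𝒳 × 𝒲 × ℝ => u.1)
    inferInstance) hτ.2).trans (condExp_condExp_of_le hm' E.comap_prediction_le)
  rw [← integral_condExp hm]
  refine integral_eq_zero_of_ae ?_
  filter_upwards [h1, h2, h4, hμ.2] with u e1 e2 e4 e5
  have e3 := congrFun h3 u
  simp only [Pi.mul_apply, Pi.sub_apply, Pi.zero_apply, Function.comp_apply] at e1 e2 e3 ⊢
  refine e1.trans (mul_eq_zero_of_right _ (e2.trans ?_))
  rw [e4, ← e5]
  exact sub_eq_zero.2 e3.symm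

/-- The function r(X)(τ - μ) is the conditional expectation of r(X)(Y - μ) given (X, F), and
conditional expectation contracts L². -/
theorem memLp_two_sqrt_mul_regression_sub {E : Experiment 𝒳 𝒲}
    {κ : Kernel 𝒳 (𝒲 × ℝ)} (hκ : E.InModel κ) {μ : 𝒳 → ℝ} (hμ : E.IsOutcomeRegression κ μ)
    {τ : 𝒳 → ℝ → ℝ} (hτ : E.IsPredictionRegression κ τ) {r : 𝒳 → ℝ} (hr : Measurable r)
    (hi : MemLp (fun u => r u.1 * (u.2.2 - μ u.1)) 2 (E.populationLaw κ)) :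
    MemLp (fun u => r u.1 * (τ u.1 (E.f u.1 u.2.1) - μ u.1)) 2 (E.populationLaw κ) := by
  have := hκ.isMarkovKernel
  have hμi := integrable_regression hμ
  have hsub : Integrable (fun u : 𝒳 × 𝒲 × ℝ => u.2.2 - μ u.1)
    (E.populationLaw κ) := hκ.integrable.sub hμi
  have h1 := condExp_mul_of_stronglyMeasurable_left
    (E.stronglyMeasurable_comap_prediction (hr.comp measurable_fst)) (hi.integrable one_le_two) hsub
  have h2 := condExp_sub hκ.integrable hμi
    (MeasurableSpace.comap (fun u : 𝒳 × 𝒲 × ℝ => (u.1, E.f u.1 u.2.1)) inferInstance)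
  have h3 := condExp_of_stronglyMeasurable E.comap_prediction_le
    (E.stronglyMeasurable_comap_prediction (hμ.1.comp measurable_fst)) hμi
  refine (hi.condExp one_le_two (m := MeasurableSpace.comap
    (fun u : 𝒳 × 𝒲 × ℝ => (u.1, E.f u.1 u.2.1)) inferInstance)).ae_eq ?_
  filter_upwards [h1, h2, hτ.2] with u e1 e2 e4
  have e3 := congrFun h3 u
  simp only [Pi.mul_apply, Pi.sub_apply, Function.comp_apply] at e1 e2 e3 ⊢
  refine e1.trans (congrArg (r u.1 * ·) (e2.trans ?_))
  rw [e4]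
  exact congrArg _ e3

/-! ### The two components of the influence function -/

/-- The inverse probability weighted residual `Δ q(X) / (π(X) p(X)) (Y - μ(X))`. -/
noncomputable def weightedResidual (E : Experiment 𝒳 𝒲) (μ : 𝒳 → ℝ) (z : 𝒳 × ℝ × ℝ × ℝ) : ℝ :=
  z.2.2.1 * E.q z.1 / (E.π z.1 * E.p z.1) * (z.2.2.2 - μ z.1)

theorem measurable_weightedResidual (E : Experiment 𝒳 𝒲) {μ : 𝒳 → ℝ} (hμ : Measurable μ) :
    Measurable (E.weightedResidual μ) := by
  have := E.measurable_q
  have := E.measurable_p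
  have := E.measurable_π
  unfold weightedResidual
  fun_prop

/-- A function of `(X, F)`, multiplied by the centered indicator `Δ - π(X)`. -/
def centeredIndicatorMul (E : Experiment 𝒳 𝒲) (b : 𝒳 × ℝ → ℝ) (z : 𝒳 × ℝ × ℝ × ℝ) : ℝ :=
  (z.2.2.1 - E.π z.1) * b (z.1, z.2.1)

theorem measurable_centeredIndicatorMul (E : Experiment 𝒳 𝒲) {b : 𝒳 × ℝ → ℝ} (hb : Measurable b) :
    Measurable (E.centeredIndicatorMul b) := by
  have := E.measurable_π
  unfold centeredIndicatorMul
  fun_prop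

/-- The coefficient `q(X) / (π(X) p(X)) (μ(X) - τ(X, F))` of `Δ - π(X)` in the influence function. -/
noncomputable def augmentation (E : Experiment 𝒳 𝒲) (μ : 𝒳 → ℝ) (τ : 𝒳 → ℝ → ℝ) (a : 𝒳 × ℝ) : ℝ :=
  E.q a.1 / (E.π a.1 * E.p a.1) * (μ a.1 - τ a.1 a.2)

theorem measurable_augmentation (E : Experiment 𝒳 𝒲) {μ : 𝒳 → ℝ} (hμ : Measurable μ)
    {τ : 𝒳 → ℝ → ℝ} (hτ : Measurable (Function.uncurry τ)) : Measurable (E.augmentation μ τ) := by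
  have h1 := E.measurable_q
  have h2 := E.measurable_p
  have h3 := E.measurable_π
  exact Measurable.mul (by fun_prop) ((hμ.comp measurable_fst).sub hτ)

theorem influence_eq (E : Experiment 𝒳 𝒲) (μ : 𝒳 → ℝ) (τ : 𝒳 → ℝ → ℝ) :
    E.influence μ τ
      = fun z => E.weightedResidual μ z + E.centeredIndicatorMul (E.augmentation μ τ) z := by
  ext ⟨x, φ, δ, v⟩
  simp only [influence, weightedResidual, centeredIndicatorMul, augmentation]
  ring

theorem measurable_influence (E : Experiment 𝒳 𝒲) {μ : 𝒳 → ℝ} (hμ : Measurable μ)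
    {τ : 𝒳 → ℝ → ℝ} (hτ : Measurable (Function.uncurry τ)) : Measurable (E.influence μ τ) := by
  rw [influence_eq]
  exact (E.measurable_weightedResidual hμ).add
    (E.measurable_centeredIndicatorMul (E.measurable_augmentation hμ hτ))

/-- On Δ = 1, which has probability π, the squared weight is (q / (π p))², and π (q / (π p))² = (q /
p)² / π. The regression stays that of κ while the law varies with κ', so the bound imposed on
regular submodels is a bound on the second moment of one fixed function. -/
theorem lintegral_sq_weightedResidual (E : Experiment 𝒳 𝒲)
    (overlap : ∀ᵐ x ∂E.ν, 0 < E.q x → 0 < E.p x ∧ 0 < E.π x)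
    {κ : Kernel 𝒳 (𝒲 × ℝ)} (hκ : E.InModel κ) {μ : 𝒳 → ℝ} (hμ : E.IsOutcomeRegression κ μ)
    (κ' : Kernel 𝒳 (𝒲 × ℝ)) [IsMarkovKernel κ'] :
    ∫⁻ z, ENNReal.ofReal (E.weightedResidual μ z ^ 2) ∂(E.observedLaw κ')
      = E.residualMoment κ κ' := by
  rw [E.lintegral_observedLaw κ' ((E.measurable_weightedResidual hμ.1).pow_const 2).ennreal_ofReal]
  refine lintegral_congr_ae ?_
  filter_upwards [E.ae_samplingLaw_of_ae κ' overlap,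
    E.ae_samplingLaw_of_ae κ' (hμ.ae_eq_integral hκ)] with u h1 h2
  rw [← ENNReal.ofReal_mul (E.π_nonneg _), ← ENNReal.ofReal_mul (sub_nonneg.2 (E.π_le_one _))]
  simp only [weightedResidual, zero_mul, zero_div, ne_eq, OfNat.ofNat_ne_zero, not_false_eq_true,
    zero_pow, mul_zero, ENNReal.ofReal_zero, add_zero, one_mul]
  congr 1
  rcases (E.q_nonneg u.1).eq_or_lt with h | h
  · simp [← h]
  · have h3 := (h1 h).2.ne'
    have h4 := (h1 h).1.ne'
    rw [h2 h]
    field_simp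

/-- The factor Δ / π has conditional mean one where q > 0, and q / p turns the sampling law into the
population law. The subtracted constant is the same for all κ', because the law of X is known. -/
theorem integral_weightedResidual (E : Experiment 𝒳 𝒲)
    (overlap : ∀ᵐ x ∂E.ν, 0 < E.q x → 0 < E.p x ∧ 0 < E.π x)
    {μ : 𝒳 → ℝ} (hμ : Measurable μ)
    (hμi : Integrable μ (E.ν.withDensity fun x => ENNReal.ofReal (E.q x)))
    {κ' : Kernel 𝒳 (𝒲 × ℝ)} (hκ' : E.InModel κ') :
    ∫ z, E.weightedResidual μ z ∂(E.observedLaw κ')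
      = E.theta κ' - ∫ x, μ x ∂(E.ν.withDensity fun x => ENNReal.ofReal (E.q x)) := by
  have := hκ'.isMarkovKernel
  have hmap : (E.populationLaw κ').map Prod.fst = E.ν.withDensity fun x => ENNReal.ofReal (E.q x) :=
    Measure.fst_compProd _ _
  have h1 : Integrable (fun u => μ u.1) (E.populationLaw κ') := by
    rw [← hmap] at hμi
    exact hμi.comp_measurable measurable_fst
  have h2 := hκ'.integrable.sub h1
  have he : (fun u => E.π u.1 * E.weightedResidual μ (u.1, E.f u.1 u.2.1, 1, u.2.2))
      =ᵐ[E.samplingLaw κ'] fun u => E.q u.1 / E.p u.1 * (u.2.2 - μ u.1) := by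
    filter_upwards [E.ae_samplingLaw_of_ae κ' overlap] with u hu
    simp only [weightedResidual]
    rcases (E.q_nonneg u.1).eq_or_lt with h | h
    · simp [← h]
    · have h3 := (hu h).2.ne'
      have h4 := (hu h).1.ne'
      field_simp
  have hi : Integrable (E.weightedResidual μ) (E.observedLaw κ') := by
    rw [E.integrable_observedLaw_iff κ' (E.measurable_weightedResidual hμ)]
    refine ⟨((E.integrable_populationLaw_iff overlap κ').1 h2).congr he.symm, ?_⟩
    simp [weightedResidual]
  rw [E.integral_observedLaw κ' (E.measurable_weightedResidual hμ) hi, integral_congr_ae he,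
    ← E.integral_populationLaw overlap κ' fun u => u.2.2 - μ u.1,
    integral_sub hκ'.integrable h1, theta, ← hmap,
    integral_map measurable_fst.aemeasurable hμ.aestronglyMeasurable]
  simp [weightedResidual]

theorem lintegral_sq_regression_sub_lt_top (E : Experiment 𝒳 𝒲)
    (overlap : ∀ᵐ x ∂E.ν, 0 < E.q x → 0 < E.p x ∧ 0 < E.π x)
    {κ : Kernel 𝒳 (𝒲 × ℝ)} (hκ : E.InModel κ) (finite_moment : E.residualMoment κ κ < ∞)
    {μ : 𝒳 → ℝ} (hμ : E.IsOutcomeRegression κ μ)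
    {τ : 𝒳 → ℝ → ℝ} (hτ : E.IsPredictionRegression κ τ) :
    ∫⁻ u, ENNReal.ofReal ((E.q u.1 / E.p u.1) ^ 2 / E.π u.1
      * (τ u.1 (E.f u.1 u.2.1) - μ u.1) ^ 2) ∂(E.samplingLaw κ) < ∞ := by
  have := hκ.isMarkovKernel
  have hq := E.measurable_q
  have hp := E.measurable_p
  have hπ := E.measurable_π
  have hμm := hμ.1
  have hτm : Measurable fun u : 𝒳 × 𝒲 × ℝ => τ u.1 (E.f u.1 u.2.1) :=
    hτ.1.comp (measurable_fst.prodMk E.measurable_prediction)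
  have hr0 : ∀ x, 0 ≤ E.q x / (E.p x * E.π x) := fun x =>
    div_nonneg (E.q_nonneg x) (mul_nonneg (E.p_nonneg x) (E.π_nonneg x))
  -- This weight r is chosen so that (q / p) r² = (q / p)² / π: the moment under the sampling law
  -- becomes an L² norm under the population law, where τ is defined as a conditional expectation.
  have hrm : Measurable fun x => √(E.q x / (E.p x * E.π x)) := by fun_prop
  have hw : ∀ x, 0 < E.q x → 0 < E.p x ∧ 0 < E.π x → ∀ y,
      E.q x / E.p x * (√(E.q x / (E.p x * E.π x)) * y) ^ 2
        = (E.q x / E.p x) ^ 2 / E.π x * y ^ 2 := by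
    intro x _ h y
    have h3 := h.1.ne'
    have h4 := h.2.ne'
    rw [mul_pow, Real.sq_sqrt (hr0 x)]
    field_simp
  have h1 : MemLp (fun u => √(E.q u.1 / (E.p u.1 * E.π u.1)) * (u.2.2 - μ u.1)) 2
      (E.populationLaw κ) := by
    have hm : Measurable fun u : 𝒳 × 𝒲 × ℝ =>
      √(E.q u.1 / (E.p u.1 * E.π u.1)) * (u.2.2 - μ u.1) := by fun_prop
    refine memLp_two_of_lintegral_sq_lt_top hm.aestronglyMeasurable (lt_of_le_of_lt ?_ finite_moment)
    rw [E.lintegral_populationLaw overlap κ (hm.pow_const 2).ennreal_ofReal]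
    refine lintegral_mono_ae ?_
    filter_upwards [E.ae_samplingLaw_of_ae κ overlap,
      E.ae_samplingLaw_of_ae κ (hμ.ae_eq_integral hκ)] with u o1 o2
    rcases (E.q_nonneg u.1).eq_or_lt with h | h
    · simp [← h]
    · rw [← ENNReal.ofReal_mul (E.q_div_p_nonneg _), hw _ h (o1 h), o2 h]
  have h2 := memLp_two_sqrt_mul_regression_sub hκ hμ hτ hrm h1
  have hm2 : Measurable fun u : 𝒳 × 𝒲 × ℝ =>
      √(E.q u.1 / (E.p u.1 * E.π u.1)) * (τ u.1 (E.f u.1 u.2.1) - μ u.1) :=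
    (hrm.comp measurable_fst).mul (hτm.sub (hμm.comp measurable_fst))
  have h3 := lintegral_sq_lt_top_of_memLp_two h2
  rw [E.lintegral_populationLaw overlap κ (hm2.pow_const 2).ennreal_ofReal] at h3
  refine lt_of_le_of_lt (le_of_eq (lintegral_congr_ae ?_)) h3
  filter_upwards [E.ae_samplingLaw_of_ae κ overlap] with u o1
  rcases (E.q_nonneg u.1).eq_or_lt with h | h
  · simp [← h]
  · rw [← ENNReal.ofReal_mul (E.q_div_p_nonneg _), hw _ h (o1 h)]

theorem memLp_two_centeredIndicatorMul_augmentation (E : Experiment 𝒳 𝒲)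
    (overlap : ∀ᵐ x ∂E.ν, 0 < E.q x → 0 < E.p x ∧ 0 < E.π x)
    {κ : Kernel 𝒳 (𝒲 × ℝ)} (hκ : E.InModel κ) (finite_moment : E.residualMoment κ κ < ∞)
    {μ : 𝒳 → ℝ} (hμ : E.IsOutcomeRegression κ μ)
    {τ : 𝒳 → ℝ → ℝ} (hτ : E.IsPredictionRegression κ τ) :
    MemLp (E.centeredIndicatorMul (E.augmentation μ τ)) 2 (E.observedLaw κ) := by
  have := hκ.isMarkovKernel
  have h3 := E.lintegral_sq_regression_sub_lt_top overlap hκ finite_moment hμ hτ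
  have hcm := E.measurable_centeredIndicatorMul (E.measurable_augmentation hμ.1 hτ.1)
  refine memLp_two_of_lintegral_sq_lt_top hcm.aestronglyMeasurable (lt_of_le_of_lt ?_ h3)
  rw [E.lintegral_observedLaw κ (hcm.pow_const 2).ennreal_ofReal]
  refine lintegral_mono_ae ?_
  filter_upwards [E.ae_samplingLaw_of_ae κ overlap] with u o1
  have n1 := E.π_nonneg u.1
  have n2 := E.π_le_one u.1
  rw [← ENNReal.ofReal_mul (E.π_nonneg _), ← ENNReal.ofReal_mul (sub_nonneg.2 (E.π_le_one _)),
    ← ENNReal.ofReal_add (by positivity) (mul_nonneg (sub_nonneg.2 n2) (sq_nonneg _))]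
  refine ENNReal.ofReal_le_ofReal ?_
  simp only [centeredIndicatorMul, augmentation]
  rcases (E.q_nonneg u.1).eq_or_lt with h | h
  · simp [← h]
  · have h3 := (o1 h).1.ne'
    have h4 := (o1 h).2.ne'
    -- The conditional variance of Δ is π (1 - π)² + (1 - π) π² = π (1 - π); its factor π cancels
    -- one of the two in the denominator.
    calc _ = (1 - E.π u.1) * ((E.q u.1 / E.p u.1) ^ 2 / E.π u.1
          * (τ u.1 (E.f u.1 u.2.1) - μ u.1) ^ 2) := by
          field_simp
          ring
      _ ≤ _ := mul_le_of_le_one_left (by positivity) (by linarith)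

/-- Holds under every κ', since given (X, W, Y) the indicator has the known mean π(X). -/
theorem integral_centeredIndicatorMul_eq_zero (E : Experiment 𝒳 𝒲) (κ' : Kernel 𝒳 (𝒲 × ℝ))
    {b : 𝒳 × ℝ → ℝ} (hb : Measurable b)
    (hi : Integrable (E.centeredIndicatorMul b) (E.observedLaw κ')) :
    ∫ z, E.centeredIndicatorMul b z ∂(E.observedLaw κ') = 0 := by
  obtain ⟨h1, h0⟩ := (E.integrable_observedLaw_iff κ' (E.measurable_centeredIndicatorMul hb)).1 hi
  rw [E.integral_observedLaw κ' (E.measurable_centeredIndicatorMul hb) hi, ← integral_add h1 h0]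
  refine integral_eq_zero_of_ae (ae_of_all _ fun u => ?_)
  simp only [centeredIndicatorMul, Pi.zero_apply]
  ring

theorem lintegral_sq_centeredIndicatorMul_le (E : Experiment 𝒳 𝒲) (κ' : Kernel 𝒳 (𝒲 × ℝ))
    [IsMarkovKernel κ'] {b : 𝒳 × ℝ → ℝ} (hb : Measurable b) {M : ℝ≥0} (hM : ∀ a, |b a| ≤ M) :
    ∫⁻ z, ENNReal.ofReal (E.centeredIndicatorMul b z ^ 2) ∂(E.observedLaw κ') ≤ (M ^ 2 : ℝ≥0) := by
  rw [E.lintegral_observedLaw κ'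
    ((E.measurable_centeredIndicatorMul hb).pow_const 2).ennreal_ofReal]
  calc _ ≤ ∫⁻ _, ((M ^ 2 : ℝ≥0) : ℝ≥0∞) ∂(E.samplingLaw κ') := by
        refine lintegral_mono fun u => ?_
        have n1 := E.π_nonneg u.1
        have n2 := sub_nonneg.2 (E.π_le_one u.1)
        have h2 := sq_le_sq' (abs_le.1 (hM (u.1, E.f u.1 u.2.1))).1
          (abs_le.1 (hM (u.1, E.f u.1 u.2.1))).2
        rw [← ENNReal.ofReal_mul n1, ← ENNReal.ofReal_mul n2,
          ← ENNReal.ofReal_add (by positivity) (by positivity), ← ENNReal.ofReal_coe_nnreal]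
        refine ENNReal.ofReal_le_ofReal ?_
        simp only [centeredIndicatorMul]
        push_cast
        set y := b (u.1, E.f u.1 u.2.1)
        calc _ = (1 - E.π u.1) * E.π u.1 * y ^ 2 := by ring
          _ ≤ y ^ 2 := mul_le_of_le_one_left (sq_nonneg _) (by nlinarith)
          _ ≤ _ := h2
    _ = _ := by simp

/-! ### The derivative of the estimand along regular submodels -/

theorem IsRegularSubmodel.isProbabilityMeasure_observedLaw {E : Experiment 𝒳 𝒲}
    {κ : Kernel 𝒳 (𝒲 × ℝ)} {path : ℝ → Kernel 𝒳 (𝒲 × ℝ)} {g : 𝒳 × ℝ × ℝ × ℝ → ℝ}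
    (hp : E.IsRegularSubmodel κ path g) (t : ℝ) : IsProbabilityMeasure (E.observedLaw (path t)) :=
  have := (hp.inModel t).isMarkovKernel
  inferInstance

/-- Since the experimentation probability is known, scores are orthogonal to every square integrable
function of the form `(Δ - π(X)) b(X, F)`. -/
theorem IsRegularSubmodel.integral_centeredIndicatorMul_mul {E : Experiment 𝒳 𝒲}
    {κ : Kernel 𝒳 (𝒲 × ℝ)} (hκ : E.InModel κ) {path : ℝ → Kernel 𝒳 (𝒲 × ℝ)}
    {g : 𝒳 × ℝ × ℝ × ℝ → ℝ} (hp : E.IsRegularSubmodel κ path g) {b : 𝒳 × ℝ → ℝ}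
    (hb : Measurable b) (hb2 : MemLp (E.centeredIndicatorMul b) 2 (E.observedLaw κ)) :
    ∫ z, E.centeredIndicatorMul b z * g z ∂(E.observedLaw κ) = 0 := by
  have := hκ.isMarkovKernel
  have := hp.isProbabilityMeasure_observedLaw
  -- For bounded b the second moment is bounded along any path, so the mean can be differentiated;
  -- it is constantly zero. Truncating b extends the identity to the square integrable case.
  have hbounded : ∀ (b : 𝒳 × ℝ → ℝ) (M : ℝ≥0), Measurable b → (∀ a, |b a| ≤ M) →
      ∫ z, E.centeredIndicatorMul b z * g z ∂(E.observedLaw κ) = 0 := by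
    intro b M hb hM
    have hcm := E.measurable_centeredIndicatorMul hb
    have hzero : ∀ t, ∫ z, E.centeredIndicatorMul b z ∂(E.observedLaw (path t)) = 0 := fun t => by
      have := (hp.inModel t).isMarkovKernel
      exact E.integral_centeredIndicatorMul_eq_zero (path t) hb
        ((memLp_two_of_lintegral_sq_lt_top hcm.aestronglyMeasurable
          ((E.lintegral_sq_centeredIndicatorMul_le (path t) hb hM).trans_lt
            ENNReal.coe_lt_top)).integrable one_le_two)
    have hzero' := hzero 0
    rw [hp.start] at hzero'
    have h := hp.differentiable.tendsto_integral hp.score_memLp hcm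
      (E.lintegral_sq_centeredIndicatorMul_le κ hb hM)
      (Eventually.of_forall fun t => by
        have := (hp.inModel t).isMarkovKernel
        exact E.lintegral_sq_centeredIndicatorMul_le (path t) hb hM)
    simp only [hzero, hzero', sub_zero, zero_div] at h
    exact tendsto_nhds_unique h tendsto_const_nhds
  have hset : ∀ n : ℕ, MeasurableSet {a | |b a| ≤ n} := fun n =>
    measurableSet_le hb.abs measurable_const
  have hlim := tendsto_integral_of_dominated_convergence (μ := E.observedLaw κ)
    (F := fun (n : ℕ) z => E.centeredIndicatorMul ({a | |b a| ≤ n}.indicator b) z * g z)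
    (f := fun z => E.centeredIndicatorMul b z * g z)
    (fun z => ‖E.centeredIndicatorMul b z * g z‖)
    (fun n => (E.measurable_centeredIndicatorMul (hb.indicator (hset n))).aestronglyMeasurable.mul
      hp.score_memLp.1)
    (hb2.integrable_mul hp.score_memLp).norm
    (fun n => ae_of_all _ fun z => by
      simp only [centeredIndicatorMul, norm_mul]
      gcongr
      exact norm_indicator_le_norm_self _ _)
    (ae_of_all _ fun z => by
      refine tendsto_const_nhds.congr' ?_
      filter_upwards [tendsto_natCast_atTop_atTop.eventually_ge_atTop |b (z.1, z.2.1)|] with n hn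
      simp only [centeredIndicatorMul]
      rw [Set.indicator_of_mem (by simpa using hn)])
  refine tendsto_nhds_unique hlim (tendsto_const_nhds.congr fun n => (hbounded _ n
    (hb.indicator (hset n)) fun a => ?_).symm)
  by_cases ha : |b a| ≤ n <;> simp [Set.indicator, ha]

theorem memLp_two_weightedResidual (E : Experiment 𝒳 𝒲)
    (overlap : ∀ᵐ x ∂E.ν, 0 < E.q x → 0 < E.p x ∧ 0 < E.π x)
    {κ : Kernel 𝒳 (𝒲 × ℝ)} (hκ : E.InModel κ) (finite_moment : E.residualMoment κ κ < ∞)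
    {μ : 𝒳 → ℝ} (hμ : E.IsOutcomeRegression κ μ) :
    MemLp (E.weightedResidual μ) 2 (E.observedLaw κ) := by
  have := hκ.isMarkovKernel
  refine memLp_two_of_lintegral_sq_lt_top
    (E.measurable_weightedResidual hμ.1).aestronglyMeasurable ?_
  rwa [E.lintegral_sq_weightedResidual overlap hκ hμ κ]

theorem memLp_two_influence (E : Experiment 𝒳 𝒲)
    (overlap : ∀ᵐ x ∂E.ν, 0 < E.q x → 0 < E.p x ∧ 0 < E.π x)
    {κ : Kernel 𝒳 (𝒲 × ℝ)} (hκ : E.InModel κ) (finite_moment : E.residualMoment κ κ < ∞)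
    {μ : 𝒳 → ℝ} (hμ : E.IsOutcomeRegression κ μ)
    {τ : 𝒳 → ℝ → ℝ} (hτ : E.IsPredictionRegression κ τ) :
    MemLp (E.influence μ τ) 2 (E.observedLaw κ) := by
  rw [influence_eq]
  exact (E.memLp_two_weightedResidual overlap hκ finite_moment hμ).add
    (E.memLp_two_centeredIndicatorMul_augmentation overlap hκ finite_moment hμ hτ)

/-- The influence function represents the derivative of the estimand along regular submodels. -/
theorem IsRegularSubmodel.tendsto_theta {E : Experiment 𝒳 𝒲}
    (overlap : ∀ᵐ x ∂E.ν, 0 < E.q x → 0 < E.p x ∧ 0 < E.π x)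
    {κ : Kernel 𝒳 (𝒲 × ℝ)} (hκ : E.InModel κ) (finite_moment : E.residualMoment κ κ < ∞)
    {μ : 𝒳 → ℝ} (hμ : E.IsOutcomeRegression κ μ)
    {τ : 𝒳 → ℝ → ℝ} (hτ : E.IsPredictionRegression κ τ)
    {path : ℝ → Kernel 𝒳 (𝒲 × ℝ)} {g : 𝒳 × ℝ × ℝ × ℝ → ℝ} (hp : E.IsRegularSubmodel κ path g) :
    Tendsto (fun t : ℝ => (E.theta (path t) - E.theta κ) / t) (𝓝[>] 0)
      (𝓝 (∫ z, E.influence μ τ z * g z ∂(E.observedLaw κ))) := by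
  have := hκ.isMarkovKernel
  have := hp.isProbabilityMeasure_observedLaw
  have hψ1 := E.memLp_two_weightedResidual overlap hκ finite_moment hμ
  have hψ2 := E.memLp_two_centeredIndicatorMul_augmentation overlap hκ finite_moment hμ hτ
  have hμi : Integrable μ (E.ν.withDensity fun x => ENNReal.ofReal (E.q x)) := by
    have hmap : (E.populationLaw κ).map Prod.fst
        = E.ν.withDensity fun x => ENNReal.ofReal (E.q x) := Measure.fst_compProd _ _
    rw [← hmap, integrable_map_measure hμ.1.aestronglyMeasurable measurable_fst.aemeasurable]
    exact integrable_regression hμ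
  obtain ⟨C, hC⟩ := hp.bounded
  -- The maximum is needed because the bound of the submodel concerns only t > 0; at κ itself the
  -- finite moment is assumed separately.
  have hlim := hp.differentiable.tendsto_integral hp.score_memLp
    (E.measurable_weightedResidual hμ.1) (C := max C (E.residualMoment κ κ).toNNReal) (by
      rw [E.lintegral_sq_weightedResidual overlap hκ hμ κ, ENNReal.coe_max,
        ENNReal.coe_toNNReal finite_moment.ne]
      exact le_max_right _ _) (by
      filter_upwards [hC] with t ht
      have := (hp.inModel t).isMarkovKernel
      rw [E.lintegral_sq_weightedResidual overlap hκ hμ (path t), ENNReal.coe_max]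
      exact ht.trans (le_max_left _ _))
  simp only [fun t => E.integral_weightedResidual overlap hμ.1 hμi (hp.inModel t),
    E.integral_weightedResidual overlap hμ.1 hμi hκ, sub_sub_sub_cancel_right] at hlim
  have he : ∫ z, E.influence μ τ z * g z ∂(E.observedLaw κ)
      = ∫ z, E.weightedResidual μ z * g z ∂(E.observedLaw κ) := by
    simp only [influence_eq, add_mul]
    rw [integral_add (by exact hψ1.integrable_mul hp.score_memLp)
        (by exact hψ2.integrable_mul hp.score_memLp),
      hp.integral_centeredIndicatorMul_mul hκ (E.measurable_augmentation hμ.1 hτ.1) hψ2, add_zero]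
  rwa [he]

/-! ### Linear perturbations of the kernel and their observed scores -/

/-- The kernel `κ`, perturbed linearly in the direction `s` of the data `(X, F, Y)`. -/
noncomputable def perturb (E : Experiment 𝒳 𝒲) (κ : Kernel 𝒳 (𝒲 × ℝ)) [IsMarkovKernel κ]
    (s : 𝒳 × ℝ × ℝ → ℝ) (t : ℝ) : Kernel 𝒳 (𝒲 × ℝ) :=
  κ.withDensity fun x v => ENNReal.ofReal (1 + t * s (E.complete (x, v)))

theorem one_add_mul_mem_Icc {t M y : ℝ} (ht : |t| * M < 1) (hy : |y| ≤ M) :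
    0 ≤ 1 + t * y ∧ 1 + t * y ≤ 2 := by
  have h : |t * y| ≤ 1 := by
    rw [abs_mul]
    exact (mul_le_mul_of_nonneg_left hy (abs_nonneg t)).trans ht.le
  have := abs_le.1 h
  constructor <;> linarith

theorem lintegral_one_add_mul {Z : Type*} [MeasurableSpace Z] {P : Measure Z}
    [IsProbabilityMeasure P] {s : Z → ℝ} (hs : Measurable s) {M : ℝ} (hM : ∀ z, |s z| ≤ M) {t : ℝ}
    (ht : |t| * M < 1) :
    ∫⁻ z, ENNReal.ofReal (1 + t * s z) ∂P = ENNReal.ofReal (1 + t * ∫ z, s z ∂P) := by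
  have hi : Integrable s P := Integrable.of_bound hs.aestronglyMeasurable M (ae_of_all _ hM)
  have hi2 : Integrable (fun z => 1 + t * s z) P := (integrable_const 1).add (hi.const_mul t)
  rw [← ofReal_integral_eq_lintegral_ofReal hi2
    (ae_of_all _ fun z => (one_add_mul_mem_Icc ht (hM z)).1),
    integral_add (integrable_const 1) (hi.const_mul t), integral_const_mul]
  simp

theorem measurable_perturb_density (E : Experiment 𝒳 𝒲) {s : 𝒳 × ℝ × ℝ → ℝ} (hs : Measurable s)
    (t : ℝ) : Measurable fun u : 𝒳 × 𝒲 × ℝ => ENNReal.ofReal (1 + t * s (E.complete u)) :=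
  (measurable_const.add ((hs.comp E.measurable_complete).const_mul t)).ennreal_ofReal

/-- The mean of s must vanish for every x, not just almost every x, since each perturbed fibre has
to be a probability measure. -/
theorem isMarkovKernel_perturb (E : Experiment 𝒳 𝒲) (κ : Kernel 𝒳 (𝒲 × ℝ)) [IsMarkovKernel κ]
    {s : 𝒳 × ℝ × ℝ → ℝ} (hs : Measurable s) {M : ℝ} (hM : ∀ a, |s a| ≤ M)
    (hs0 : ∀ x, ∫ v, s (E.complete (x, v)) ∂(κ x) = 0) {t : ℝ} (ht : |t| * M < 1) :
    IsMarkovKernel (E.perturb κ s t) := by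
  refine ⟨fun x => ⟨?_⟩⟩
  have hsx : Measurable fun v : 𝒲 × ℝ => s (E.complete (x, v)) :=
    (hs.comp E.measurable_complete).comp measurable_prodMk_left
  rw [perturb, Kernel.withDensity_apply' _ (E.measurable_perturb_density hs t), setLIntegral_univ,
    lintegral_one_add_mul hsx (fun v => hM _) ht, hs0]
  simp

theorem compProd_perturb (E : Experiment 𝒳 𝒲) (κ : Kernel 𝒳 (𝒲 × ℝ)) [IsMarkovKernel κ]
    {s : 𝒳 × ℝ × ℝ → ℝ} (hs : Measurable s) (t : ℝ) [IsMarkovKernel (E.perturb κ s t)]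
    (ρ : Measure 𝒳) [SFinite ρ] :
    ρ ⊗ₘ E.perturb κ s t
      = (ρ ⊗ₘ κ).withDensity fun u => ENNReal.ofReal (1 + t * s (E.complete u)) := by
  have hd := E.measurable_perturb_density hs t
  unfold perturb at *
  exact Measure.compProd_withDensity hd

/-- A density bounded by 2 carries both integrability of Y and finiteness of the residual moment
over to the perturbed kernel. -/
theorem compProd_perturb_le (E : Experiment 𝒳 𝒲) (κ : Kernel 𝒳 (𝒲 × ℝ)) [IsMarkovKernel κ]
    {s : 𝒳 × ℝ × ℝ → ℝ} (hs : Measurable s) {M : ℝ} (hM : ∀ a, |s a| ≤ M) {t : ℝ}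
    (ht : |t| * M < 1) [IsMarkovKernel (E.perturb κ s t)] (ρ : Measure 𝒳) [SFinite ρ] :
    ρ ⊗ₘ E.perturb κ s t ≤ (2 : ℝ≥0∞) • (ρ ⊗ₘ κ) := by
  rw [E.compProd_perturb κ hs t ρ, ← withDensity_const]
  refine withDensity_mono (ae_of_all _ fun u => ?_)
  calc _ ≤ ENNReal.ofReal 2 := ENNReal.ofReal_le_ofReal (one_add_mul_mem_Icc ht (hM _)).2
    _ = 2 := by simp

theorem inModel_perturb (E : Experiment 𝒳 𝒲) {κ : Kernel 𝒳 (𝒲 × ℝ)} (hκ : E.InModel κ)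
    [IsMarkovKernel κ] {s : 𝒳 × ℝ × ℝ → ℝ} (hs : Measurable s) {M : ℝ} (hM : ∀ a, |s a| ≤ M)
    (hs0 : ∀ x, ∫ v, s (E.complete (x, v)) ∂(κ x) = 0) {t : ℝ} (ht : |t| * M < 1) :
    E.InModel (E.perturb κ s t) := by
  have h := E.isMarkovKernel_perturb κ hs hM hs0 ht
  exact ⟨h, hκ.integrable.of_measure_le_smul ENNReal.ofNat_ne_top
    (E.compProd_perturb_le κ hs hM ht _)⟩

theorem residualMoment_perturb_le (E : Experiment 𝒳 𝒲) {κ : Kernel 𝒳 (𝒲 × ℝ)}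
    [IsMarkovKernel κ] {s : 𝒳 × ℝ × ℝ → ℝ} (hs : Measurable s) {M : ℝ} (hM : ∀ a, |s a| ≤ M)
    (hs0 : ∀ x, ∫ v, s (E.complete (x, v)) ∂(κ x) = 0) {t : ℝ} (ht : |t| * M < 1) :
    E.residualMoment κ (E.perturb κ s t) ≤ 2 * E.residualMoment κ κ := by
  have h := E.isMarkovKernel_perturb κ hs hM hs0 ht
  unfold residualMoment
  rw [← smul_eq_mul, ← lintegral_smul_measure]
  exact lintegral_mono' (E.compProd_perturb_le κ hs hM ht _) le_rfl

/-- The conditional mean of `s(X, F, Y)` given `(X, F)` for a sampled individual. -/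
noncomputable def predictionMean (E : Experiment 𝒳 𝒲) (κ : Kernel 𝒳 (𝒲 × ℝ)) [IsMarkovKernel κ]
    (s : 𝒳 × ℝ × ℝ → ℝ) (a : 𝒳 × ℝ) : ℝ :=
  ∫ y, s (a.1, a.2, y) ∂(condDistrib (fun u : 𝒳 × 𝒲 × ℝ => u.2.2)
    (fun u => (u.1, E.f u.1 u.2.1)) (E.samplingLaw κ) a)

theorem measurable_predictionMean (E : Experiment 𝒳 𝒲) (κ : Kernel 𝒳 (𝒲 × ℝ)) [IsMarkovKernel κ]
    {s : 𝒳 × ℝ × ℝ → ℝ} (hs : Measurable s) : Measurable (E.predictionMean κ s) := by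
  have h : StronglyMeasurable fun b : (𝒳 × ℝ) × ℝ => s (b.1.1, b.1.2, b.2) :=
    (hs.comp (by fun_prop)).stronglyMeasurable
  exact (h.integral_kernel_prod_right' (κ := condDistrib (fun u : 𝒳 × 𝒲 × ℝ => u.2.2)
    (fun u => (u.1, E.f u.1 u.2.1)) (E.samplingLaw κ))).measurable

theorem abs_predictionMean_le (E : Experiment 𝒳 𝒲) (κ : Kernel 𝒳 (𝒲 × ℝ)) [IsMarkovKernel κ]
    {s : 𝒳 × ℝ × ℝ → ℝ} {M : ℝ} (hM : ∀ a, |s a| ≤ M) (a : 𝒳 × ℝ) :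
    |E.predictionMean κ s a| ≤ M := by
  have := norm_integral_le_of_norm_le_const (μ := condDistrib (fun u : 𝒳 × 𝒲 × ℝ => u.2.2)
    (fun u => (u.1, E.f u.1 u.2.1)) (E.samplingLaw κ) a) (f := fun y => s (a.1, a.2, y))
    (C := M) (ae_of_all _ fun y => hM _)
  simpa [predictionMean] using this

theorem map_samplingLaw_eq_compProd (E : Experiment 𝒳 𝒲) (κ : Kernel 𝒳 (𝒲 × ℝ))
    [IsMarkovKernel κ] :
    (E.samplingLaw κ).map (fun u => ((u.1, E.f u.1 u.2.1), u.2.2))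
      = (E.samplingLaw κ).map (fun u => (u.1, E.f u.1 u.2.1))
        ⊗ₘ condDistrib (fun u : 𝒳 × 𝒲 × ℝ => u.2.2)
          (fun u => (u.1, E.f u.1 u.2.1)) (E.samplingLaw κ) :=
  (compProd_map_condDistrib (measurable_snd.snd).aemeasurable).symm

theorem integral_mul_predictionMean (E : Experiment 𝒳 𝒲) (κ : Kernel 𝒳 (𝒲 × ℝ))
    [IsMarkovKernel κ] {s : 𝒳 × ℝ × ℝ → ℝ} (hs : Measurable s) {M : ℝ} (hM : ∀ a, |s a| ≤ M)
    {w : 𝒳 × ℝ → ℝ} (hw : Measurable w)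
    (hi : Integrable (fun u => w (u.1, E.f u.1 u.2.1)) (E.samplingLaw κ)) :
    ∫ u, w (u.1, E.f u.1 u.2.1) * E.predictionMean κ s (u.1, E.f u.1 u.2.1) ∂(E.samplingLaw κ)
      = ∫ u, w (u.1, E.f u.1 u.2.1) * s (E.complete u) ∂(E.samplingLaw κ) := by
  have hXF : Measurable fun u : 𝒳 × 𝒲 × ℝ => (u.1, E.f u.1 u.2.1) :=
    measurable_fst.prodMk E.measurable_prediction
  have hXFY : Measurable fun u : 𝒳 × 𝒲 × ℝ => ((u.1, E.f u.1 u.2.1), u.2.2) :=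
    hXF.prodMk measurable_snd.snd
  have hm : Measurable fun b : (𝒳 × ℝ) × ℝ => w b.1 * s (b.1.1, b.1.2, b.2) :=
    (hw.comp measurable_fst).mul (hs.comp (by fun_prop))
  have hi2 : Integrable (fun u => w (u.1, E.f u.1 u.2.1) * s (E.complete u)) (E.samplingLaw κ) :=
    hi.mul_bdd (c := M) (hs.comp E.measurable_complete).aestronglyMeasurable
      (ae_of_all _ fun u => hM _)
  have hi3 : Integrable (fun b : (𝒳 × ℝ) × ℝ => w b.1 * s (b.1.1, b.1.2, b.2))
      ((E.samplingLaw κ).map (fun u => ((u.1, E.f u.1 u.2.1), u.2.2))) :=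
    (integrable_map_measure hm.aestronglyMeasurable hXFY.aemeasurable).2 hi2
  have h1 := integral_map hXFY.aemeasurable hm.aestronglyMeasurable (μ := E.samplingLaw κ)
  rw [E.map_samplingLaw_eq_compProd κ] at hi3
  rw [E.map_samplingLaw_eq_compProd κ, Measure.integral_compProd hi3] at h1
  refine Eq.trans ?_ h1
  simp_rw [integral_const_mul]
  exact (integral_map hXF.aemeasurable
    (hw.mul (E.measurable_predictionMean κ hs)).aestronglyMeasurable).symm

/-- The tower property given (X, F): since |t| M < 1, the density 1 + t s is nonnegative, so
`ENNReal.ofReal` does not truncate and averaging over Y commutes with it. -/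
theorem lintegral_mul_predictionMean (E : Experiment 𝒳 𝒲) (κ : Kernel 𝒳 (𝒲 × ℝ))
    [IsMarkovKernel κ] {s : 𝒳 × ℝ × ℝ → ℝ} (hs : Measurable s) {M : ℝ} (hM : ∀ a, |s a| ≤ M)
    {t : ℝ} (ht : |t| * M < 1) {H : 𝒳 × ℝ → ℝ≥0∞} (hH : Measurable H) :
    ∫⁻ u, H (u.1, E.f u.1 u.2.1)
        * ENNReal.ofReal (1 + t * E.predictionMean κ s (u.1, E.f u.1 u.2.1)) ∂(E.samplingLaw κ)
      = ∫⁻ u, H (u.1, E.f u.1 u.2.1) * ENNReal.ofReal (1 + t * s (E.complete u))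
        ∂(E.samplingLaw κ) := by
  have hXF : Measurable fun u : 𝒳 × 𝒲 × ℝ => (u.1, E.f u.1 u.2.1) :=
    measurable_fst.prodMk E.measurable_prediction
  have hXFY : Measurable fun u : 𝒳 × 𝒲 × ℝ => ((u.1, E.f u.1 u.2.1), u.2.2) :=
    hXF.prodMk measurable_snd.snd
  have hsm : Measurable fun b : (𝒳 × ℝ) × ℝ => s (b.1.1, b.1.2, b.2) := hs.comp (by fun_prop)
  have hm : Measurable fun b : (𝒳 × ℝ) × ℝ =>
      H b.1 * ENNReal.ofReal (1 + t * s (b.1.1, b.1.2, b.2)) :=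
    (hH.comp measurable_fst).mul (measurable_const.add (hsm.const_mul t)).ennreal_ofReal
  have h1 := lintegral_map hm hXFY (μ := E.samplingLaw κ)
  rw [E.map_samplingLaw_eq_compProd κ, Measure.lintegral_compProd hm] at h1
  refine Eq.trans ?_ h1
  have hm2 : Measurable fun a : 𝒳 × ℝ =>
      H a * ENNReal.ofReal (1 + t * E.predictionMean κ s a) :=
    hH.mul (measurable_const.add ((E.measurable_predictionMean κ hs).const_mul t)).ennreal_ofReal
  rw [← lintegral_map hm2 hXF]
  refine lintegral_congr fun a => ?_
  have ha : Measurable fun y => s (a.1, a.2, y) := hs.comp (by fun_prop)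
  refine Eq.trans ?_ (lintegral_const_mul (H a)
    (measurable_const.add (ha.const_mul t)).ennreal_ofReal).symm
  exact congrArg (H a * ·) (lintegral_one_add_mul ha (fun y => hM _) ht).symm

open Classical in
/-- The score of the linear perturbation in the direction `s`: the conditional mean of `s(X, F, Y)`
given the observation. -/
noncomputable def observedScore (E : Experiment 𝒳 𝒲) (κ : Kernel 𝒳 (𝒲 × ℝ)) [IsMarkovKernel κ]
    (s : 𝒳 × ℝ × ℝ → ℝ) (z : 𝒳 × ℝ × ℝ × ℝ) : ℝ :=
  if z.2.2.1 = 1 then s (z.1, z.2.1, z.2.2.2) else E.predictionMean κ s (z.1, z.2.1)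

theorem measurable_observedScore (E : Experiment 𝒳 𝒲) (κ : Kernel 𝒳 (𝒲 × ℝ)) [IsMarkovKernel κ]
    {s : 𝒳 × ℝ × ℝ → ℝ} (hs : Measurable s) : Measurable (E.observedScore κ s) :=
  Measurable.ite (measurableSet_eq_fun (by fun_prop) measurable_const) (hs.comp (by fun_prop))
    ((E.measurable_predictionMean κ hs).comp (by fun_prop))

theorem abs_observedScore_le (E : Experiment 𝒳 𝒲) (κ : Kernel 𝒳 (𝒲 × ℝ)) [IsMarkovKernel κ]
    {s : 𝒳 × ℝ × ℝ → ℝ} {M : ℝ} (hM : ∀ a, |s a| ≤ M) (z : 𝒳 × ℝ × ℝ × ℝ) :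
    |E.observedScore κ s z| ≤ M := by
  unfold observedScore
  split_ifs
  exacts [hM _, E.abs_predictionMean_le κ hM _]

/-- On Δ = 1 the outcome is seen and the likelihood ratio is 1 + t s. On Δ = 0 the ratio is averaged
over Y given (X, F); the factor 1 - π depends only on X, so it does not affect this average. -/
theorem observedLaw_perturb (E : Experiment 𝒳 𝒲) (κ : Kernel 𝒳 (𝒲 × ℝ)) [IsMarkovKernel κ]
    {s : 𝒳 × ℝ × ℝ → ℝ} (hs : Measurable s) {M : ℝ} (hM : ∀ a, |s a| ≤ M)
    (hs0 : ∀ x, ∫ v, s (E.complete (x, v)) ∂(κ x) = 0) {t : ℝ} (ht : |t| * M < 1) :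
    E.observedLaw (E.perturb κ s t)
      = (E.observedLaw κ).withDensity
          fun z => ENNReal.ofReal (1 + t * E.observedScore κ s z) := by
  have h := E.isMarkovKernel_perturb κ hs hM hs0 ht
  have hd := E.measurable_perturb_density hs t
  have hgm : Measurable fun z => ENNReal.ofReal (1 + t * E.observedScore κ s z) :=
    (measurable_const.add ((E.measurable_observedScore κ hs).const_mul t)).ennreal_ofReal
  refine Measure.ext_of_lintegral _ fun G hG => ?_
  have h1 : Measurable fun u : 𝒳 × 𝒲 × ℝ => G (u.1, E.f u.1 u.2.1, 1, u.2.2) :=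
    hG.comp E.measurable_treated
  have h0 : Measurable fun u : 𝒳 × 𝒲 × ℝ => G (u.1, E.f u.1 u.2.1, 0, 0) :=
    hG.comp E.measurable_untreated
  have hπ1 := E.measurable_π_fst (𝒲 := 𝒲).ennreal_ofReal
  have hπ0 := ((E.measurable_π_fst (𝒲 := 𝒲)).const_sub 1).ennreal_ofReal
  have hH : Measurable fun a : 𝒳 × ℝ => ENNReal.ofReal (1 - E.π a.1) * G (a.1, a.2, 0, 0) :=
    ((E.measurable_π.comp measurable_fst).const_sub 1).ennreal_ofReal.mul (hG.comp (by fun_prop))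
  have hsamp : E.samplingLaw (E.perturb κ s t)
      = (E.samplingLaw κ).withDensity fun u => ENNReal.ofReal (1 + t * s (E.complete u)) :=
    E.compProd_perturb κ hs t _
  have hA : Measurable fun u : 𝒳 × 𝒲 × ℝ =>
      ENNReal.ofReal (E.π u.1) * G (u.1, E.f u.1 u.2.1, 1, u.2.2)
        + ENNReal.ofReal (1 - E.π u.1) * G (u.1, E.f u.1 u.2.1, 0, 0) :=
    (hπ1.mul h1).add (hπ0.mul h0)
  have key := E.lintegral_mul_predictionMean κ hs hM ht hH
  rw [E.lintegral_observedLaw _ hG, lintegral_withDensity_eq_lintegral_mul _ hgm hG,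
    E.lintegral_observedLaw _ (hgm.mul hG), hsamp,
    lintegral_withDensity_eq_lintegral_mul _ hd hA]
  simp only [Pi.mul_apply, observedScore, if_true, zero_ne_one, if_false, mul_add]
  rw [lintegral_add_left (by exact hd.mul (hπ1.mul h1)),
    lintegral_add_left (by exact hπ1.mul (hd.mul h1))]
  congr 1
  · exact lintegral_congr fun u => mul_left_comm _ _ _
  · refine Eq.trans ?_ (key.symm.trans ?_)
    · exact lintegral_congr fun u => mul_comm _ _
    · exact lintegral_congr fun u => by ring

open Classical in
/-- The submodel of the linear perturbations of `κ` in the direction `s`. -/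
noncomputable def linearPath (E : Experiment 𝒳 𝒲) (κ : Kernel 𝒳 (𝒲 × ℝ)) [IsMarkovKernel κ]
    (s : 𝒳 × ℝ × ℝ → ℝ) (M : ℝ) (t : ℝ) : Kernel 𝒳 (𝒲 × ℝ) :=
  if |t| * M < 1 then E.perturb κ s t else κ

theorem eventually_abs_mul_lt_one (M : ℝ) : ∀ᶠ t in 𝓝[>] (0 : ℝ), |t| * M < 1 := by
  have h : ContinuousAt (fun t : ℝ => |t| * M) 0 := by fun_prop
  have := h.tendsto.mono_left (nhdsWithin_le_nhds (s := Set.Ioi 0))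
  exact this.eventually (gt_mem_nhds (by simp))

/-- For small t the path is the linear perturbation, which determines the score and the moment
bound. For other t it falls back to κ, so that it stays in the model for every real t. -/
theorem isRegularSubmodel_linearPath (E : Experiment 𝒳 𝒲) {κ : Kernel 𝒳 (𝒲 × ℝ)}
    (hκ : E.InModel κ) [IsMarkovKernel κ] (finite_moment : E.residualMoment κ κ < ∞)
    {s : 𝒳 × ℝ × ℝ → ℝ} (hs : Measurable s) {M : ℝ} (hM : ∀ a, |s a| ≤ M)
    (hs0 : ∀ x, ∫ v, s (E.complete (x, v)) ∂(κ x) = 0) {g : 𝒳 × ℝ × ℝ × ℝ → ℝ}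
    (hg : E.observedScore κ s =ᵐ[E.observedLaw κ] g) :
    E.IsRegularSubmodel κ (E.linearPath κ s M) g := by
  have hgm := E.measurable_observedScore κ hs
  have hgM := E.abs_observedScore_le κ hM
  have hin : ∀ t, E.InModel (E.linearPath κ s M t) := fun t => by
    unfold linearPath
    split_ifs with ht
    exacts [E.inModel_perturb hκ hs hM hs0 ht, hκ]
  have hprob : ∀ t, IsProbabilityMeasure (E.observedLaw (E.linearPath κ s M t)) := fun t => by
    have := (hin t).isMarkovKernel
    infer_instance
  refine ⟨?_, hin, ?_, ?_, ⟨(2 * E.residualMoment κ κ).toNNReal, ?_⟩⟩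
  · simp only [linearPath, abs_zero, zero_mul, zero_lt_one, if_true, perturb, add_zero,
      ENNReal.ofReal_one]
    exact Kernel.withDensity_one' κ
  · exact (MemLp.of_bound hgm.aestronglyMeasurable M (ae_of_all _ hgM)).ae_eq hg
  · refine (differentiableInQuadraticMean_withDensity hgm hgM ?_).congr_score hg
    filter_upwards [eventually_abs_mul_lt_one M] with t ht
    rw [linearPath, if_pos ht, E.observedLaw_perturb κ hs hM hs0 ht]
  · filter_upwards [eventually_abs_mul_lt_one M] with t ht
    rw [linearPath, if_pos ht, ENNReal.coe_toNNReal
      (ENNReal.mul_ne_top ENNReal.ofNat_ne_top finite_moment.ne)]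
    exact E.residualMoment_perturb_le hs hM hs0 ht

/-! ### The orthogonal complement of the scores -/

/-- The mean of `h` over the indicator `Δ`, given `(X, F, Y)`. -/
def indicatorMean (E : Experiment 𝒳 𝒲) (h : 𝒳 × ℝ × ℝ × ℝ → ℝ) (a : 𝒳 × ℝ × ℝ) : ℝ :=
  E.π a.1 * h (a.1, a.2.1, 1, a.2.2) + (1 - E.π a.1) * h (a.1, a.2.1, 0, 0)

theorem measurable_indicatorMean (E : Experiment 𝒳 𝒲) {h : 𝒳 × ℝ × ℝ × ℝ → ℝ}
    (hh : Measurable h) : Measurable (E.indicatorMean h) := by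
  have := E.measurable_π
  exact Measurable.add (Measurable.mul (by fun_prop) (hh.comp (by fun_prop)))
    (Measurable.mul (by fun_prop) (hh.comp (by fun_prop)))

/-- Jensen's inequality for a two-point law: the gap between the mean of the squares and the square
of the mean is π (1 - π) times the squared difference of the two values. -/
theorem memLp_two_indicatorMean (E : Experiment 𝒳 𝒲) (κ : Kernel 𝒳 (𝒲 × ℝ))
    {h : 𝒳 × ℝ × ℝ × ℝ → ℝ} (hh : Measurable h) (hh2 : MemLp h 2 (E.observedLaw κ)) :
    MemLp (fun u => E.indicatorMean h (E.complete u)) 2 (E.samplingLaw κ) := by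
  refine memLp_two_of_lintegral_sq_lt_top
    ((E.measurable_indicatorMean hh).comp E.measurable_complete).aestronglyMeasurable
    (lt_of_le_of_lt ?_ (lintegral_sq_lt_top_of_memLp_two hh2))
  rw [E.lintegral_observedLaw κ (hh.pow_const 2).ennreal_ofReal]
  refine lintegral_mono fun u => ?_
  have n1 := E.π_nonneg u.1
  have n2 := sub_nonneg.2 (E.π_le_one u.1)
  rw [← ENNReal.ofReal_mul n1, ← ENNReal.ofReal_mul n2,
    ← ENNReal.ofReal_add (by positivity) (by positivity)]
  refine ENNReal.ofReal_le_ofReal ?_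
  simp only [indicatorMean, complete]
  nlinarith [mul_nonneg (mul_nonneg n1 n2)
    (sq_nonneg (h (u.1, E.f u.1 u.2.1, 1, u.2.2) - h (u.1, E.f u.1 u.2.1, 0, 0)))]

/-- The maps s ↦ E[s | Z] and h ↦ E[h | X, F, Y] are adjoint, which moves orthogonality from the
observation to the data (X, F, Y). -/
theorem integral_mul_observedScore (E : Experiment 𝒳 𝒲) (κ : Kernel 𝒳 (𝒲 × ℝ))
    [IsMarkovKernel κ] {h : 𝒳 × ℝ × ℝ × ℝ → ℝ} (hh : Measurable h)
    (hi : Integrable h (E.observedLaw κ)) {s : 𝒳 × ℝ × ℝ → ℝ} (hs : Measurable s) {M : ℝ}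
    (hM : ∀ a, |s a| ≤ M) :
    ∫ z, h z * E.observedScore κ s z ∂(E.observedLaw κ)
      = ∫ u, E.indicatorMean h (E.complete u) * s (E.complete u) ∂(E.samplingLaw κ) := by
  have hgm := E.measurable_observedScore κ hs
  have hsm := (hs.comp E.measurable_complete).aestronglyMeasurable (μ := E.samplingLaw κ)
  obtain ⟨i1, i0⟩ := (E.integrable_observedLaw_iff κ hh).1 hi
  have hi' : Integrable (fun z => h z * E.observedScore κ s z) (E.observedLaw κ) :=
    hi.mul_bdd (c := M) hgm.aestronglyMeasurable (ae_of_all _ (E.abs_observedScore_le κ hM))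
  have hm : Measurable fun z => h z * E.observedScore κ s z := hh.mul hgm
  rw [E.integral_observedLaw κ hm hi']
  have hw : Measurable fun a : 𝒳 × ℝ => (1 - E.π a.1) * h (a.1, a.2, 0, 0) :=
    ((E.measurable_π.comp measurable_fst).const_sub 1).mul (hh.comp (by fun_prop))
  have key := E.integral_mul_predictionMean κ hs hM hw i0
  simp only [observedScore, if_true, zero_ne_one, if_false, ← mul_assoc]
  rw [key, ← integral_add]
  · simp only [indicatorMean, add_mul, complete]
  · exact i1.mul_bdd (c := M) hsm (ae_of_all _ fun u => hM _)
  · exact i0.mul_bdd (c := M) hsm (ae_of_all _ fun u => hM _)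

/-- A function of `(X, F, Y)` that is orthogonal to all bounded functions with conditional mean zero
given `X` is a function of `X`. -/
theorem ae_eq_integral_of_forall_integral_mul_eq_zero (E : Experiment 𝒳 𝒲)
    (κ : Kernel 𝒳 (𝒲 × ℝ)) [IsMarkovKernel κ] {k : 𝒳 × ℝ × ℝ → ℝ} (hk : Measurable k)
    (hi : Integrable (fun u => k (E.complete u)) (E.samplingLaw κ))
    (horth : ∀ s : 𝒳 × ℝ × ℝ → ℝ, Measurable s → (∀ a, |s a| ≤ 1) →
      (∀ x, ∫ v, s (E.complete (x, v)) ∂(κ x) = 0) →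
      ∫ u, k (E.complete u) * s (E.complete u) ∂(E.samplingLaw κ) = 0) :
    ∀ᵐ u ∂(E.samplingLaw κ), k (E.complete u) = ∫ v, k (E.complete (u.1, v)) ∂(κ u.1) := by
  set c : 𝒳 → ℝ := fun x => ∫ v, k (E.complete (x, v)) ∂(κ x) with hc
  have hcm : Measurable c :=
    ((hk.comp E.measurable_complete).stronglyMeasurable.integral_kernel_prod_right'
      (κ := κ)).measurable
  have hic : Integrable c (E.ν.withDensity fun x => ENNReal.ofReal (E.p x)) :=
    Integrable.integral_compProd (κ := Kernel.const Unit _) (η := Kernel.prodMkLeft Unit κ)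
      (a := ()) hi
  have hmap : (E.samplingLaw κ).map Prod.fst = E.ν.withDensity fun x => ENNReal.ofReal (E.p x) :=
    Measure.fst_compProd _ _
  have hic' : Integrable (fun u : 𝒳 × 𝒲 × ℝ => c u.1) (E.samplingLaw κ) := by
    rw [← hmap] at hic
    exact hic.comp_measurable measurable_fst
  have hd : Measurable fun a : 𝒳 × ℝ × ℝ => k a - c a.1 := hk.sub (hcm.comp measurable_fst)
  have hdi : Integrable (fun a : 𝒳 × ℝ × ℝ => k a - c a.1) ((E.samplingLaw κ).map E.complete) :=
    (integrable_map_measure hd.aestronglyMeasurable E.measurable_complete.aemeasurable).2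
      (hi.sub hic')
  -- For each set A, test with s = e - m, where e is the indicator of A and m its mean given X. As
  -- conditional expectation given X is self-adjoint, ∫ k m = ∫ c e, so the orthogonality reads ∫ (k
  -- - c) e = 0.
  have hzero := hdi.ae_eq_zero_of_forall_setIntegral_eq_zero fun A hA _ => by
    set e : 𝒳 × ℝ × ℝ → ℝ := A.indicator fun _ => 1 with he
    have hem : Measurable e := measurable_const.indicator hA
    have he0 : ∀ a, 0 ≤ e a := fun a => Set.indicator_nonneg (fun _ _ => zero_le_one) a
    have he1 : ∀ a, e a ≤ 1 := fun a => Set.indicator_le_self' (fun _ _ => zero_le_one) a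
    have heb : ∀ a, ‖e a‖ ≤ 1 := fun a => by
      rw [Real.norm_of_nonneg (he0 a)]; exact he1 a
    have hecm := hem.comp E.measurable_complete
    set m : 𝒳 → ℝ := fun x => ∫ v, e (E.complete (x, v)) ∂(κ x) with hm
    have hmm : Measurable m :=
      (hecm.stronglyMeasurable.integral_kernel_prod_right' (κ := κ)).measurable
    have hex : ∀ x, Integrable (fun v => e (E.complete (x, v))) (κ x) := fun x =>
      Integrable.of_bound (hecm.comp measurable_prodMk_left).aestronglyMeasurable 1
        (ae_of_all _ fun v => heb _)
    have hm0 : ∀ x, 0 ≤ m x := fun x => integral_nonneg fun v => he0 _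
    have hm1 : ∀ x, m x ≤ 1 := fun x => by
      have := integral_mono (hex x) (integrable_const 1) fun v => he1 _
      simpa using this
    have hmb : ∀ x, ‖m x‖ ≤ 1 := fun x => by
      rw [Real.norm_of_nonneg (hm0 x)]; exact hm1 x
    have h1 := horth (fun a => e a - m a.1) (hem.sub (hmm.comp measurable_fst))
      (fun a => abs_le.2 ⟨by linarith [he0 a, hm1 a.1], by linarith [he1 a, hm0 a.1]⟩)
      (fun x => by
        refine (integral_sub (hex x) (integrable_const (m x))).trans ?_
        simp [hm])
    have ike : Integrable (fun u => k (E.complete u) * e (E.complete u)) (E.samplingLaw κ) :=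
      hi.mul_bdd (c := 1) hecm.aestronglyMeasurable (ae_of_all _ fun u => heb _)
    have ikm : Integrable (fun u => k (E.complete u) * m u.1) (E.samplingLaw κ) :=
      hi.mul_bdd (c := 1) (hmm.comp measurable_fst).aestronglyMeasurable
        (ae_of_all _ fun u => hmb _)
    have ice : Integrable (fun u => c u.1 * e (E.complete u)) (E.samplingLaw κ) :=
      hic'.mul_bdd (c := 1) hecm.aestronglyMeasurable (ae_of_all _ fun u => heb _)
    have h2 : ∫ u, k (E.complete u) * m u.1 ∂(E.samplingLaw κ)
        = ∫ u, c u.1 * e (E.complete u) ∂(E.samplingLaw κ) := by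
      refine (Measure.integral_compProd ikm).trans (Eq.trans ?_ (Measure.integral_compProd ice).symm)
      simp_rw [integral_mul_const, integral_const_mul]
      rfl
    have h3 : ∫ u, (k (E.complete u) * e (E.complete u) - k (E.complete u) * m u.1)
        ∂(E.samplingLaw κ) = 0 := by
      rw [← h1]
      exact integral_congr_ae (ae_of_all _ fun u => (mul_sub _ _ _).symm)
    rw [integral_sub ike ikm, h2, ← integral_sub ike ice] at h3
    rw [← integral_indicator hA, integral_map E.measurable_complete.aemeasurable
      (hd.indicator hA).aestronglyMeasurable, ← h3]
    refine integral_congr_ae (ae_of_all _ fun u => ?_)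
    by_cases hu : E.complete u ∈ A
    · simp only [he, Set.indicator_of_mem hu, mul_one]
      rfl
    · simp [he, hu]
  filter_upwards [ae_of_ae_map E.measurable_complete.aemeasurable hzero] with u hu
  exact sub_eq_zero.1 hu

/-- A square integrable function that is orthogonal to the scores of all linear perturbations is
orthogonal to the influence function. -/
theorem integral_mul_influence_eq_zero (E : Experiment 𝒳 𝒲)
    (overlap : ∀ᵐ x ∂E.ν, 0 < E.q x → 0 < E.p x ∧ 0 < E.π x)
    {κ : Kernel 𝒳 (𝒲 × ℝ)} (hκ : E.InModel κ) [IsMarkovKernel κ]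
    (finite_moment : E.residualMoment κ κ < ∞)
    {μ : 𝒳 → ℝ} (hμ : E.IsOutcomeRegression κ μ)
    {τ : 𝒳 → ℝ → ℝ} (hτ : E.IsPredictionRegression κ τ)
    {h : 𝒳 × ℝ × ℝ × ℝ → ℝ} (hh : Measurable h) (hh2 : MemLp h 2 (E.observedLaw κ))
    (horth : ∀ s : 𝒳 × ℝ × ℝ → ℝ, Measurable s → (∀ a, |s a| ≤ 1) →
      (∀ x, ∫ v, s (E.complete (x, v)) ∂(κ x) = 0) →
      ∫ z, h z * E.observedScore κ s z ∂(E.observedLaw κ) = 0) :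
    ∫ z, h z * E.influence μ τ z ∂(E.observedLaw κ) = 0 := by
  have hk2 := E.memLp_two_indicatorMean κ hh hh2
  have hhi := hh2.integrable one_le_two
  have hkm := E.measurable_indicatorMean hh
  set c : 𝒳 → ℝ := fun x => ∫ v, E.indicatorMean h (E.complete (x, v)) ∂(κ x) with hc
  have hcm : Measurable c :=
    ((hkm.comp E.measurable_complete).stronglyMeasurable.integral_kernel_prod_right'
      (κ := κ)).measurable
  have hkc : ∀ᵐ u ∂(E.samplingLaw κ), E.indicatorMean h (E.complete u) = c u.1 :=
    E.ae_eq_integral_of_forall_integral_mul_eq_zero κ hkm (hk2.integrable one_le_two)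
      fun s hs hs1 hs0 => by
        rw [← E.integral_mul_observedScore κ hh hhi hs hs1]
        exact horth s hs hs1 hs0
  have hψm := E.measurable_influence hμ.1 hτ.1
  have hψ2 := E.memLp_two_influence overlap hκ finite_moment hμ hτ
  have hhψ : Integrable (fun z => h z * E.influence μ τ z) (E.observedLaw κ) :=
    hh2.integrable_mul hψ2
  have hhψm : Measurable fun z => h z * E.influence μ τ z := hh.mul hψm
  obtain ⟨i1, i0⟩ := (E.integrable_observedLaw_iff κ hhψm).1 hhψ
  rw [E.integral_observedLaw κ hhψm hhψ, ← integral_add i1 i0]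
  have htot := i1.add i0
  -- Solve π h(X, F, 1, Y) + (1 - π) h(X, F, 0, 0) = c(X) for the value on Δ = 1. The solution w
  -- does not involve Y; the division by π matters only where q > 0, and there π > 0.
  set w : 𝒳 × ℝ → ℝ := fun a => (c a.1 - (1 - E.π a.1) * h (a.1, a.2, 0, 0)) / E.π a.1 with hw
  have hwm : Measurable w := by
    have h1 := E.measurable_π
    have h2 : Measurable fun a : 𝒳 × ℝ => h (a.1, a.2, 0, 0) := hh.comp (by fun_prop)
    fun_prop
  -- Write Y - μ = (Y - τ) + (τ - μ). The coefficient of (q / p)(τ - μ) collects to π h(X, F, 1, Y)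
  -- + (1 - π) h(X, F, 0, 0), which is c(X).
  have heq : (fun u => E.π u.1 * (h (u.1, E.f u.1 u.2.1, 1, u.2.2)
        * E.influence μ τ (u.1, E.f u.1 u.2.1, 1, u.2.2))
      + (1 - E.π u.1) * (h (u.1, E.f u.1 u.2.1, 0, 0)
        * E.influence μ τ (u.1, E.f u.1 u.2.1, 0, 0)))
      =ᵐ[E.samplingLaw κ] fun u =>
        E.q u.1 / E.p u.1 * (w (u.1, E.f u.1 u.2.1) * (u.2.2 - τ u.1 (E.f u.1 u.2.1)))
        + E.q u.1 / E.p u.1 * (c u.1 * (τ u.1 (E.f u.1 u.2.1) - μ u.1)) := by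
    filter_upwards [E.ae_samplingLaw_of_ae κ overlap, hkc] with u o1 o2
    simp only [indicatorMean, complete] at o2
    simp only [influence, hw, ← o2]
    rcases (E.q_nonneg u.1).eq_or_lt with hq | hq
    · simp [← hq]
    · have h3 := (o1 hq).1.ne'
      have h4 := (o1 hq).2.ne'
      field_simp
      ring
  have hl2 : MemLp (fun u => E.q u.1 / E.p u.1 * (τ u.1 (E.f u.1 u.2.1) - μ u.1)) 2
      (E.samplingLaw κ) := by
    have hm : Measurable fun u : 𝒳 × 𝒲 × ℝ =>
        E.q u.1 / E.p u.1 * (τ u.1 (E.f u.1 u.2.1) - μ u.1) :=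
      E.measurable_q_div_p_fst.mul ((hτ.1.comp (measurable_fst.prodMk E.measurable_prediction)).sub
        (hμ.1.comp measurable_fst))
    refine memLp_two_of_lintegral_sq_lt_top hm.aestronglyMeasurable (lt_of_le_of_lt ?_
      (E.lintegral_sq_regression_sub_lt_top overlap hκ finite_moment hμ hτ))
    refine lintegral_mono_ae ?_
    filter_upwards [E.ae_samplingLaw_of_ae κ overlap] with u o1
    refine ENNReal.ofReal_le_ofReal ?_
    rw [mul_pow]
    refine mul_le_mul_of_nonneg_right ?_ (sq_nonneg _)
    rcases (E.q_nonneg u.1).eq_or_lt with hq | hq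
    · simp [← hq]
    · exact le_div_self (sq_nonneg _) (o1 hq).2 (E.π_le_one _)
  have j2 : Integrable (fun u => E.q u.1 / E.p u.1 * (c u.1 * (τ u.1 (E.f u.1 u.2.1) - μ u.1)))
      (E.samplingLaw κ) := by
    refine (hk2.integrable_mul hl2).congr ?_
    filter_upwards [hkc] with u hu
    simp only [Pi.mul_apply]
    rw [hu]
    ring
  -- Obtained by subtraction from the integrable total, so no separate bound on w is required.
  have j1 : Integrable (fun u => E.q u.1 / E.p u.1
      * (w (u.1, E.f u.1 u.2.1) * (u.2.2 - τ u.1 (E.f u.1 u.2.1)))) (E.samplingLaw κ) := by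
    refine ((htot.congr heq).sub j2).congr (ae_of_all _ fun u => ?_)
    simp
  rw [integral_congr_ae heq, integral_add j1 j2, ← E.integral_populationLaw overlap κ
      fun u => w (u.1, E.f u.1 u.2.1) * (u.2.2 - τ u.1 (E.f u.1 u.2.1)),
    ← E.integral_populationLaw overlap κ fun u => c u.1 * (τ u.1 (E.f u.1 u.2.1) - μ u.1),
    integral_mul_sub_predictionRegression_eq_zero hκ hτ hwm
      ((E.integrable_populationLaw_iff overlap κ).2 j1),
    integral_mul_regression_sub_eq_zero hκ hμ hτ hcm
      ((E.integrable_populationLaw_iff overlap κ).2 j2), add_zero]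

/-- In a Hilbert space the closure of a subspace is its double orthogonal complement, and the scores
of the linear perturbations with |s| ≤ 1 are enough to test a vector of the orthogonal complement.
-/
theorem toLp_influence_mem_closure (E : Experiment 𝒳 𝒲)
    (overlap : ∀ᵐ x ∂E.ν, 0 < E.q x → 0 < E.p x ∧ 0 < E.π x)
    {κ : Kernel 𝒳 (𝒲 × ℝ)} (hκ : E.InModel κ) (finite_moment : E.residualMoment κ κ < ∞)
    {μ : 𝒳 → ℝ} (hμ : E.IsOutcomeRegression κ μ)
    {τ : 𝒳 → ℝ → ℝ} (hτ : E.IsPredictionRegression κ τ)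
    (hψ : MemLp (E.influence μ τ) 2 (E.observedLaw κ)) :
    hψ.toLp (E.influence μ τ) ∈ (Submodule.span ℝ (E.tangentSet κ)).topologicalClosure := by
  have := hκ.isMarkovKernel
  rw [← Submodule.orthogonal_orthogonal_eq_closure, Submodule.mem_orthogonal]
  intro h hh
  rw [Submodule.mem_orthogonal'] at hh
  have hzero := E.integral_mul_influence_eq_zero overlap hκ finite_moment hμ hτ
    (Lp.stronglyMeasurable h).measurable (Lp.memLp h) fun s hs hs1 hs0 => by
      have hg : MemLp (E.observedScore κ s) 2 (E.observedLaw κ) :=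
        MemLp.of_bound (E.measurable_observedScore κ hs).aestronglyMeasurable 1
          (ae_of_all _ (E.abs_observedScore_le κ hs1))
      have hmem : hg.toLp _ ∈ E.tangentSet κ :=
        ⟨_, E.isRegularSubmodel_linearPath hκ finite_moment hs hs1 hs0 hg.coeFn_toLp.symm⟩
      have := hh _ (Submodule.subset_span hmem)
      rw [L2.inner_def] at this
      rw [← this]
      refine integral_congr_ae ?_
      filter_upwards [hg.coeFn_toLp] with z hz
      simp [hz, mul_comm]
  rw [L2.inner_def, ← hzero]
  refine integral_congr_ae ?_
  filter_upwards [hψ.coeFn_toLp] with z hz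
  simp [hz, mul_comm]

/-! ### Uniqueness and conclusion -/

/-- Two efficient influence functions agree almost everywhere. -/
theorem IsEfficientInfluenceFunction.ae_eq {E : Experiment 𝒳 𝒲} {κ : Kernel 𝒳 (𝒲 × ℝ)}
    {ψ ψ' : 𝒳 × ℝ × ℝ × ℝ → ℝ} (h : E.IsEfficientInfluenceFunction κ ψ)
    (h' : E.IsEfficientInfluenceFunction κ ψ') : ψ =ᵐ[E.observedLaw κ] ψ' := by
  obtain ⟨hd, hψ, hc⟩ := h
  obtain ⟨hd', hψ', hc'⟩ := h'
  set d := hψ.toLp ψ - hψ'.toLp ψ' with hdef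
  have hdmem : d ∈ (Submodule.span ℝ (E.tangentSet κ)).topologicalClosure :=
    Submodule.sub_mem _ hc hc'
  -- Both functions represent the same derivative, so d is orthogonal to every score. The orthogonal
  -- complement of d is closed, hence contains the closed span and therefore d itself.
  have hspan : Submodule.span ℝ (E.tangentSet κ) ≤ (Submodule.span ℝ {d})ᗮ := by
    refine Submodule.span_le.2 ?_
    rintro g ⟨path, hp⟩
    rw [SetLike.mem_coe, Submodule.mem_orthogonal_singleton_iff_inner_right, hdef, inner_sub_left,
      L2.inner_def, L2.inner_def, sub_eq_zero]
    refine Eq.trans ?_ ((tendsto_nhds_unique (hd path g hp) (hd' path g hp)).trans ?_)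
    · refine integral_congr_ae ?_
      filter_upwards [hψ.coeFn_toLp] with z hz
      simp [hz, mul_comm]
    · refine integral_congr_ae ?_
      filter_upwards [hψ'.coeFn_toLp] with z hz
      simp [hz, mul_comm]
  have hd0 := Submodule.topologicalClosure_minimal _ hspan
    (Submodule.isClosed_orthogonal _) hdmem
  rw [Submodule.mem_orthogonal_singleton_iff_inner_right, inner_self_eq_zero, hdef,
    sub_eq_zero] at hd0
  exact (hψ.toLp_eq_toLp_iff hψ').1 hd0

end Experiment

theorem mainTheorem5 {𝒳 𝒲 : Type*} [MeasurableSpace 𝒳] [MeasurableSpace 𝒲]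
    (E : Experiment 𝒳 𝒲)
    (overlap : ∀ᵐ x ∂E.ν, 0 < E.q x → 0 < E.p x ∧ 0 < E.π x)
    (κ : Kernel 𝒳 (𝒲 × ℝ)) (hκ : E.InModel κ)
    (finite_moment : E.residualMoment κ κ < ∞)
    (μ : 𝒳 → ℝ) (hμ : E.IsOutcomeRegression κ μ)
    (τ : 𝒳 → ℝ → ℝ) (hτ : E.IsPredictionRegression κ τ) :
    E.IsEfficientInfluenceFunction κ (E.influence μ τ) ∧
      ∀ ψ, E.IsEfficientInfluenceFunction κ ψ → ψ =ᵐ[E.observedLaw κ] E.influence μ τ := by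
  have hψ := E.memLp_two_influence overlap hκ finite_moment hμ hτ
  have h : E.IsEfficientInfluenceFunction κ (E.influence μ τ) :=
    ⟨fun path g hp => hp.tendsto_theta overlap hκ finite_moment hμ hτ, hψ,
      E.toLp_influence_mem_closure overlap hκ finite_moment hμ hτ hψ⟩
  exact ⟨h, fun ψ h' => h'.ae_eq h⟩
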